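/- Notation. $\nu(y)$ is the exponent of $2$ in a rational or $2$-adic number $y$, with $\nu(0)=\infty$; $\alpha(m)$ is the number of $1$'s in the binary expansion of $m$; $\lg(m)=[\log_2 m]$; and, for $n\ge1$, $$\Phi_n(s)=\frac1{n!}\sum_i\binom n{2i+1}(2i)^s\quad(s\ge0),\qquad P_n(x)=\frac1{n!}\sum_{j\text{ odd}}\binom nj j^x\quad(x\in\mathbb Z).$$ $P_n$ also denotes the continuous extension of this function to the $2$-adic integers $\mathbb Z_2$. Binomial coefficients $\binom mk$ are defined for all integers $m$ and $k\ge0$ by $\binom mk=m(m-1)\cdots(m-k+1)/k!$. Theorem. Let $3\cdot2^{e-1}<n<2^{e+1}$. Suppose $0\le p\le[(n-3\cdot2^{e-1})/2]$, $(n,p)\ne(2^{e+1}-1,0)$, and $\binom{n-1-p}p$ is odd. Let $\ell=\lg(2^{e+1}-(n-p))$, let $q=p+\varepsilon\cdot2^{\nu(n)-1}$ be an integer with $\varepsilon\in\{0,1\}$ (so $\varepsilon=0$ if $n$ is odd), and let $\delta\in\{0,1\}$. (a) For all $x\in\mathbb Z$, $k\ge0$ and $j>0$, $$\nu\left(\binom{2^ex+\delta2^{e-1}+q}k\binom{2^e}j\Phi_n(j+k)\right)\ge\alpha(n)-1-\alpha(p),$$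 with equality if and only if $(j,k)=(2^e-2^\ell,\,p)$, or $\delta=1$ and $$(j,k)\in\{(2^{e-1}-2^\ell,\,2^{e-1}+p),\ (2^{e-1},\,2^{e-1}+p-2^\ell)\}.$$ (b) There exists a $2$-adic integer $x_\delta$ such that for all integers $x$ $$\nu(P_n(2^ex+2^{e-1}\delta+q))=\nu(x-x_\delta)+\alpha(n)-1-\alpha(p),$$ and $2^ex_\delta+2^{e-1}\delta+q$ is the unique zero of $P_n$ among the $2$-adic integers congruent to $2^{e-1}\delta+q$ mod $2^e$. -/

import Mathlib

/-- The exponent of `2` in a `2`-adic number, with value `∞` (i.e. `⊤`) at `0`. Integers and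
rational numbers are regarded as `2`-adic numbers. -/
noncomputable def nu (y : ℚ_[2]) : WithTop ℤ := Padic.addValuation y

/-- The number of `1`'s in the binary expansion of `n`. -/
def binOnes (n : ℕ) : ℕ := (Nat.digits 2 n).sum

/-- `Φ_n(s) = (1 / n!) ∑_i C(n, 2i+1) (2i)^s`; the terms with `2i + 1 > n` vanish. -/
def Phi (n s : ℕ) : ℚ :=
  (1 / (n.factorial : ℚ)) * ∑ i ∈ Finset.range n, (n.choose (2 * i + 1) : ℚ) * (2 * (i : ℚ)) ^ s

/-- The partial Stirling numbers `P_n(x) = (1 / n!) ∑_{j odd} C(n, j) j^x` for integers `x`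
(of any sign), the odd `j` being written `2i + 1`. -/
def partialStirling (n : ℕ) (x : ℤ) : ℚ :=
  (1 / (n.factorial : ℚ)) *
    ∑ i ∈ Finset.range n, (n.choose (2 * i + 1) : ℚ) * (2 * (i : ℚ) + 1) ^ x

theorem tendsto_two_mul_pow (i : ℕ) :
    Filter.Tendsto (fun m : ℕ => ((2 * i : ℕ) : ℤ_[2]) ^ m) Filter.atTop (nhds 0) := by
  rw [tendsto_pow_atTop_nhds_zero_iff_norm_lt_one]
  exact PadicInt.norm_lt_one_iff_dvd _ |>.2 (by push_cast; exact Dvd.intro _ rfl)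

/-- The power `(2i + 1)^x` for a `2`-adic integer exponent `x`: the continuous additive
character of `ℤ_2` with value `1 + 2i` at `1`. -/
noncomputable def oddPow (i : ℕ) (x : ℤ_[2]) : ℤ_[2] :=
  PadicInt.addChar_of_value_at_one ((2 * i : ℕ) : ℤ_[2]) (tendsto_two_mul_pow i) x

/-- The partial Stirling function `P_n` on the `2`-adic integers. The two theorems below show
that it is the (unique) continuous extension of `partialStirling n`. -/
noncomputable def partialStirlingFun (n : ℕ) (x : ℤ_[2]) : ℚ_[2] :=
  (1 / (n.factorial : ℚ_[2])) *
    ∑ i ∈ Finset.range n, (n.choose (2 * i + 1) : ℚ_[2]) * (oddPow i x : ℚ_[2])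

theorem continuous_partialStirlingFun (n : ℕ) : Continuous (partialStirlingFun n) := by
  have h (i : ℕ) : Continuous fun x : ℤ_[2] => (oddPow i x : ℚ_[2]) :=
    Continuous.comp (g := fun y : ℤ_[2] => (y : ℚ_[2])) continuous_subtype_val
      (PadicInt.continuous_addChar_of_value_at_one (p := 2) (R := ℤ_[2]) (tendsto_two_mul_pow i))
  unfold partialStirlingFun
  fun_prop

theorem oddPow_intCast (i : ℕ) (x : ℤ) :
    ((oddPow i (x : ℤ_[2]) : ℤ_[2]) : ℚ_[2]) = (2 * (i : ℚ_[2]) + 1) ^ x := by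
  have hnat : ∀ m : ℕ, ((oddPow i (m : ℤ_[2]) : ℤ_[2]) : ℚ_[2]) = (2 * (i : ℚ_[2]) + 1) ^ m := by
    intro m
    have h := AddChar.map_nsmul_eq_pow
      (PadicInt.addChar_of_value_at_one (p := 2) (R := ℤ_[2]) ((2 * i : ℕ) : ℤ_[2]) (tendsto_two_mul_pow i)) m 1
    rw [PadicInt.addChar_of_value_at_one_def, nsmul_one] at h
    rw [oddPow, h]
    rw [add_comm]
    push_cast
    rfl
  obtain ⟨m, rfl | rfl⟩ := x.eq_nat_or_neg
  · simpa using hnat m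
  · have h : oddPow i (-(m : ℤ_[2])) * oddPow i (m : ℤ_[2]) = 1 := by
      unfold oddPow
      rw [← AddChar.map_add_eq_mul, neg_add_cancel, AddChar.map_zero_eq_one]
    have h' := congrArg (fun z : ℤ_[2] => (z : ℚ_[2])) h
    simp only [PadicInt.coe_mul, PadicInt.coe_one, hnat] at h'
    rw [zpow_neg, zpow_natCast]
    push_cast
    exact eq_inv_of_mul_eq_one_left h'

theorem partialStirlingFun_intCast (n : ℕ) (x : ℤ) :
    partialStirlingFun n (x : ℤ_[2]) = (partialStirling n x : ℚ_[2]) := by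
  simp only [partialStirlingFun, partialStirling, oddPow_intCast]
  push_cast
  rfl

/-! Put t = α(n)-1-α(p). Expanding i^s in the basis C(i,m) and using ∑ C(n,2i+1) C(i,m) = 2^(n-1-2m)
C(n-1-m,m) for 2m < n (`sum_choose_odd_mul_choose`) writes Φ_n(s) as a sum over m ≤ s of 2^s
Δ^m(x^s)(0) 2^(n-1-2m) C(n-1-m,m)/n!. The difference Δ^m(x^s)(0) is s! for m = s, and in general is
divisible by m! and, 2-adically, by 2^(m-α(s)). So the term m = s has valuation exactly
α(n)-1-α(s)+ν(C(n-1-s,s)), and the others are bounded below.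

For (a), multiply by C(Y,k) C(2^e,j) with s = j+k, where ν(C(2^e,j)) = e-ν(j). The claim becomes an
inequality of digit sums, obtained by cutting j+k at binary position ν(j): the digits below are
those of k and are paid for by ν(C(Y,k)) and α(p); those above are at most e-ν(j) in number when j+k
< 2^e. Terms with m < s never reach t (`weight_lt_of_lt`); for m = s the bound is `weight_le`, and
equality is settled by `minimalPair_of_weight_eq` and `weight_eq_of_minimalPair`. If ε = 1, the
extra digit of q costs one unit, which is recovered from divisibility of C(n-1-m,m) or from slack in
the other estimates.

For (b), P_n(y+2^(e+d))-P_n(y) is the sum over j > 0 and k of C(y,k) C(2^(e+d),j) Φ_n(j+k).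
Replacing e by e+d in the second binomial adds d to the bound and keeps the minimal pairs. Their
number is one or three, hence odd, so the increment has valuation exactly t+d. Thus x ↦ P_n(2^e
x+2^(e-1)δ+q) scales 2-adic distances by 2^(-t); its value at 0 is divisible by 2^t, so it has a
zero, necessarily unique. -/

/-! ### Binary digit sums and Kummer's theorem. -/

theorem binOnes_zero : binOnes 0 = 0 := by simp [binOnes]

theorem binOnes_one : binOnes 1 = 1 := by simp [binOnes]

theorem binOnes_add_choose (a b : ℕ) :
    padicValNat 2 ((a + b).choose a) + binOnes (a + b) = binOnes a + binOnes b := by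
  have h := @sub_one_mul_padicValNat_choose_eq_sub_sum_digits' 2 a b _
  -- Makes the natural subtraction in `h` exact; it follows from Legendre's formula and a! b! ∣
  -- (a+b)!.
  have h2 : (Nat.digits 2 (b + a)).sum ≤ (Nat.digits 2 a).sum + (Nat.digits 2 b).sum := by
    have h0 := @sub_one_mul_padicValNat_factorial 2 _ a
    have h1 := @sub_one_mul_padicValNat_factorial 2 _ b
    have h3 := @sub_one_mul_padicValNat_factorial 2 _ (b + a)
    have h4 := Nat.digit_sum_le 2 a
    have h5 := Nat.digit_sum_le 2 b
    have h6 := Nat.digit_sum_le 2 (b + a)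
    have h7 : padicValNat 2 a.factorial + padicValNat 2 b.factorial ≤
        padicValNat 2 (b + a).factorial := by
      rw [← padicValNat.mul (Nat.factorial_ne_zero _) (Nat.factorial_ne_zero _),
        ← padicValNat_dvd_iff_le (Nat.factorial_ne_zero _), mul_comm]
      exact pow_padicValNat_dvd.trans (Nat.factorial_mul_factorial_dvd_factorial_add b a)
    omega
  rw [add_comm b a] at h h2
  unfold binOnes
  omega

theorem binOnes_choose {n k : ℕ} (h : k ≤ n) :
    padicValNat 2 (n.choose k) + binOnes n = binOnes k + binOnes (n - k) := by
  obtain ⟨b, rfl⟩ := Nat.exists_eq_add_of_le h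
  simpa using binOnes_add_choose k b

theorem binOnes_add_le (a b : ℕ) : binOnes (a + b) ≤ binOnes a + binOnes b := by
  have := binOnes_add_choose a b
  omega

theorem binOnes_le (a : ℕ) : binOnes a ≤ a := Nat.digit_sum_le 2 a

theorem binOnes_pred_add_one {z : ℕ} (hz : 0 < z) :
    binOnes (z - 1) + 1 = binOnes z + padicValNat 2 z := by
  have := binOnes_choose (n := z) (k := 1) hz
  rw [Nat.choose_one_right, binOnes_one] at this
  omega

theorem binOnes_two_mul (a : ℕ) : binOnes (2 * a) = binOnes a := by
  rcases Nat.eq_zero_or_pos a with rfl | h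
  · rfl
  · unfold binOnes
    rw [Nat.digits_def' (by norm_num) (by omega)]
    simp

theorem binOnes_two_mul_add_one (a : ℕ) : binOnes (2 * a + 1) = binOnes a + 1 := by
  unfold binOnes
  rw [Nat.digits_def' (by norm_num) (by omega)]
  simp [add_comm]
  congr 3; omega

theorem binOnes_pow_mul_add (a x : ℕ) {y : ℕ} (hy : y < 2 ^ a) :
    binOnes (2 ^ a * x + y) = binOnes x + binOnes y := by
  induction a generalizing y with
  | zero =>
    obtain rfl : y = 0 := by simpa using hy
    simp [binOnes_zero]
  | succ a ih =>
    have h1 : y / 2 < 2 ^ a := by rw [pow_succ] at hy; omega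
    have h2 := ih h1
    rcases Nat.even_or_odd' y with ⟨z, rfl | rfl⟩
    · have h3 : 2 ^ (a + 1) * x + 2 * z = 2 * (2 ^ a * x + z) := by ring
      rw [h3, binOnes_two_mul, binOnes_two_mul]
      simpa using h2
    · have h3 : 2 ^ (a + 1) * x + (2 * z + 1) = 2 * (2 ^ a * x + z) + 1 := by ring
      rw [h3, binOnes_two_mul_add_one, binOnes_two_mul_add_one, ← add_assoc]
      have h4 : (2 * z + 1) / 2 = z := by omega
      rw [h4] at h2
      rw [h2]

theorem binOnes_pow_mul (a x : ℕ) : binOnes (2 ^ a * x) = binOnes x := by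
  have := binOnes_pow_mul_add a x (y := 0) (by positivity)
  simpa [binOnes_zero] using this

theorem binOnes_two_pow (a : ℕ) : binOnes (2 ^ a) = 1 := by
  have := binOnes_pow_mul a 1
  simpa [binOnes_one] using this

theorem binOnes_two_pow_add {a y : ℕ} (hy : y < 2 ^ a) : binOnes (2 ^ a + y) = 1 + binOnes y := by
  have := binOnes_pow_mul_add a 1 hy
  simpa [binOnes_one] using this

theorem binOnes_div_add_mod (a x : ℕ) :
    binOnes x = binOnes (x / 2 ^ a) + binOnes (x % 2 ^ a) := by
  conv_lhs => rw [← Nat.div_add_mod x (2 ^ a)]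
  exact binOnes_pow_mul_add a _ (Nat.mod_lt _ (by positivity))

/-- Subtraction from 2^a-1 flips each of the a low digits. -/
theorem binOnes_compl {a z : ℕ} (hz : z < 2 ^ a) : binOnes (2 ^ a - 1 - z) + binOnes z = a := by
  induction a generalizing z with
  | zero =>
    obtain rfl : z = 0 := by simpa using hz
    simp [binOnes_zero]
  | succ a ih =>
    rw [pow_succ] at hz ⊢
    rcases Nat.even_or_odd' z with ⟨w, rfl | rfl⟩
    · have h : 2 ^ a * 2 - 1 - 2 * w = 2 * (2 ^ a - 1 - w) + 1 := by omega
      rw [h, binOnes_two_mul_add_one, binOnes_two_mul]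
      have := ih (z := w) (by omega)
      omega
    · have h : 2 ^ a * 2 - 1 - (2 * w + 1) = 2 * (2 ^ a - 1 - w) := by omega
      rw [h, binOnes_two_mul_add_one, binOnes_two_mul]
      have := ih (z := w) (by omega)
      omega

theorem binOnes_le_of_lt {a z : ℕ} (hz : z < 2 ^ a) : binOnes z ≤ a := by
  have := binOnes_compl hz
  omega

theorem binOnes_eq_zero {z : ℕ} (hz : binOnes z = 0) : z = 0 := by
  induction z using Nat.strong_induction_on with
  | _ z ih =>
    rcases Nat.even_or_odd' z with ⟨w, rfl | rfl⟩
    · rw [binOnes_two_mul] at hz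
      by_contra h
      have := ih w (by omega) hz
      omega
    · rw [binOnes_two_mul_add_one] at hz
      omega

theorem binOnes_pos {z : ℕ} (hz : 0 < z) : 0 < binOnes z := by
  by_contra h
  have := binOnes_eq_zero (z := z) (by omega)
  omega

theorem eq_of_binOnes_eq {a z : ℕ} (hz : z < 2 ^ a) (h : binOnes z = a) : z = 2 ^ a - 1 := by
  have h1 := binOnes_compl hz
  have := binOnes_eq_zero (z := 2 ^ a - 1 - z) (by omega)
  omega

theorem eq_two_pow_of_binOnes_eq_one {z : ℕ} (hz : binOnes z = 1) : ∃ a, z = 2 ^ a := by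
  induction z using Nat.strong_induction_on with
  | _ z ih =>
    rcases Nat.even_or_odd' z with ⟨w, rfl | rfl⟩
    · rw [binOnes_two_mul] at hz
      have hw : w ≠ 0 := by
        rintro rfl
        simp [binOnes_zero] at hz
      obtain ⟨a, rfl⟩ := ih w (by omega) hz
      exact ⟨a + 1, by ring⟩
    · rw [binOnes_two_mul_add_one] at hz
      have := binOnes_eq_zero (z := w) (by omega)
      exact ⟨0, by simp [this]⟩

theorem padicValNat_factorial_add_binOnes (n : ℕ) :
    padicValNat 2 n.factorial + binOnes n = n := by
  have h := @sub_one_mul_padicValNat_factorial 2 _ n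
  have := binOnes_le n
  unfold binOnes at *
  omega

/-! ### Cutting binomial coefficients at a binary position. -/

/-- Splitting off the low binary digits of a binomial coefficient, without a borrow. -/
theorem padicValNat_choose_split_le {u Y₁ Y₂ K₁ K₂ : ℕ} (hY : Y₁ < 2 ^ u) (hK : K₁ ≤ Y₁)
    (h : 2 ^ u * K₂ + K₁ ≤ 2 ^ u * Y₂ + Y₁) :
    K₂ ≤ Y₂ ∧ padicValNat 2 ((2 ^ u * Y₂ + Y₁).choose (2 ^ u * K₂ + K₁)) =
      padicValNat 2 (Y₁.choose K₁) + padicValNat 2 (Y₂.choose K₂) := by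
  have h2 : K₂ ≤ Y₂ := by
    by_contra hc
    have : 2 ^ u * (Y₂ + 1) ≤ 2 ^ u * K₂ := Nat.mul_le_mul_left _ (by omega)
    rw [mul_add] at this
    omega
  refine ⟨h2, ?_⟩
  have e1 := binOnes_choose h
  have e2 := binOnes_choose hK
  have e3 := binOnes_choose h2
  obtain ⟨d, rfl⟩ := Nat.exists_eq_add_of_le h2
  have e4 : 2 ^ u * (K₂ + d) + Y₁ - (2 ^ u * K₂ + K₁) = 2 ^ u * d + (Y₁ - K₁) := by
    rw [mul_add]; omega
  rw [e4, binOnes_pow_mul_add _ _ (by omega), binOnes_pow_mul_add _ _ (by omega),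
    binOnes_pow_mul_add _ _ (by omega)] at e1
  rw [Nat.add_sub_cancel_left] at e3
  omega

/-- Splitting off the low binary digits of a binomial coefficient, with a borrow. -/
theorem padicValNat_choose_split_lt {u Y₁ Y₂ K₁ K₂ : ℕ} (hK' : K₁ < 2 ^ u) (hK : Y₁ < K₁)
    (h : 2 ^ u * K₂ + K₁ ≤ 2 ^ u * Y₂ + Y₁) :
    K₂ < Y₂ ∧ padicValNat 2 ((2 ^ u * Y₂ + Y₁).choose (2 ^ u * K₂ + K₁)) + binOnes Y₁ + 1 =
      padicValNat 2 (Y₂.choose K₂) + padicValNat 2 (Y₂ - K₂) + binOnes K₁ +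
        binOnes (2 ^ u + Y₁ - K₁) := by
  have h2 : K₂ < Y₂ := by
    by_contra hc
    have : 2 ^ u * Y₂ ≤ 2 ^ u * K₂ := Nat.mul_le_mul_left _ (by omega)
    omega
  refine ⟨h2, ?_⟩
  have e1 := binOnes_choose h
  have e3 := binOnes_choose h2.le
  obtain ⟨d, rfl⟩ := Nat.exists_eq_add_of_lt h2
  -- The borrow lowers the upper difference to d = Y₂-K₂-1; passing from α(d) to α(d+1) produces the
  -- term ν(Y₂-K₂).
  have e4 : 2 ^ u * (K₂ + d + 1) + Y₁ - (2 ^ u * K₂ + K₁) = 2 ^ u * d + (2 ^ u + Y₁ - K₁) := by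
    rw [mul_add, mul_add]; omega
  have e5 : K₂ + d + 1 - K₂ = d + 1 := by omega
  rw [e4, binOnes_pow_mul_add _ _ (by omega), binOnes_pow_mul_add _ _ (by omega),
    binOnes_pow_mul_add _ _ (by omega)] at e1
  rw [e5] at e3 ⊢
  have e6 := binOnes_pred_add_one (z := d + 1) (by omega)
  rw [Nat.add_sub_cancel] at e6
  omega

/-- Kummer's formula on the u low digits. A borrow does no harm, since 2^u+Y₁-K₁ is positive and so
has a digit 1. -/
theorem binOnes_mod_le_choose {Y K : ℕ} (u : ℕ) (h : K ≤ Y) :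
    binOnes (K % 2 ^ u) ≤ padicValNat 2 (Y.choose K) + binOnes (Y % 2 ^ u) := by
  have hp : 0 < 2 ^ u := by positivity
  have hY := Nat.div_add_mod Y (2 ^ u)
  have hK := Nat.div_add_mod K (2 ^ u)
  have hY1 := Nat.mod_lt Y hp
  have hK1 := Nat.mod_lt K hp
  set Y₁ := Y % 2 ^ u
  set K₁ := K % 2 ^ u
  have h' := h
  rw [← hY, ← hK] at h' ⊢
  rcases le_or_gt K₁ Y₁ with hc | hc
  · have := (padicValNat_choose_split_le hY1 hc h').2
    have := binOnes_choose hc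
    omega
  · obtain ⟨h1, h2⟩ := padicValNat_choose_split_lt hK1 hc h'
    have := binOnes_pos (z := 2 ^ u + Y₁ - K₁) (by omega)
    omega

/-- If the lowest `w + 1` digits of `Y` are those of `2 ^ w`, then the digits of `K` below them
contribute to the valuation of the binomial coefficient, unless they are those of `2 ^ w`. -/
theorem binOnes_mod_add_choose_le {Y K w : ℕ} (h : K ≤ Y) (hY : Y % 2 ^ (w + 1) = 2 ^ w)
    (hK : K % 2 ^ (w + 1) ≠ 2 ^ w) :
    K / 2 ^ (w + 1) ≤ Y / 2 ^ (w + 1) ∧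
    binOnes (K % 2 ^ (w + 1)) + padicValNat 2 ((Y / 2 ^ (w + 1)).choose (K / 2 ^ (w + 1))) ≤
      padicValNat 2 (Y.choose K) := by
  have hp : 0 < 2 ^ (w + 1) := by positivity
  have hY0 := Nat.div_add_mod Y (2 ^ (w + 1))
  have hK0 := Nat.div_add_mod K (2 ^ (w + 1))
  have hK1 := Nat.mod_lt K hp
  rw [hY] at hY0
  have hs : 2 ^ (w + 1) = 2 * 2 ^ w := by ring
  have hw : 0 < 2 ^ w := by positivity
  set K₁ := K % 2 ^ (w + 1)
  set Y₂ := Y / 2 ^ (w + 1)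
  set K₂ := K / 2 ^ (w + 1)
  have h' := h
  rw [← hY0, ← hK0] at h'
  rw [← hY0, ← hK0]
  rcases le_or_gt K₁ (2 ^ w) with hc | hc
  · obtain ⟨h1, h2⟩ := padicValNat_choose_split_le (by omega) hc h'
    refine ⟨h1, ?_⟩
    have h3 := binOnes_choose hc
    have h4 := binOnes_pos (z := 2 ^ w - K₁) (by omega)
    rw [binOnes_two_pow] at h3
    omega
  · obtain ⟨h1, h2⟩ := padicValNat_choose_split_lt hK1 hc h'
    refine ⟨h1.le, ?_⟩
    have h3 := binOnes_pos (z := 2 ^ (w + 1) - K₁) (by omega)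
    have h4 : 2 ^ (w + 1) + 2 ^ w - K₁ = 2 ^ w + (2 ^ (w + 1) - K₁) := by omega
    rw [binOnes_two_pow, h4, binOnes_two_pow_add (by omega)] at h2
    omega

/-- The lowest digit of Y plays no role when K has no digit up to that position. This is what
removes the term 2^(ν(n)-1) from q. -/
theorem padicValNat_choose_sub_two_pow {Y K w : ℕ} (h : K ≤ Y) (hY : Y % 2 ^ (w + 1) = 2 ^ w)
    (hK : 2 ^ (w + 1) ∣ K) :
    K ≤ Y - 2 ^ w ∧ padicValNat 2 (Y.choose K) = padicValNat 2 ((Y - 2 ^ w).choose K) := by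
  have hY0 := Nat.div_add_mod Y (2 ^ (w + 1))
  rw [hY] at hY0
  obtain ⟨K₂, rfl⟩ := hK
  have hs : 2 ^ (w + 1) = 2 * 2 ^ w := by ring
  have hw : 0 < 2 ^ w := by positivity
  set Y₂ := Y / 2 ^ (w + 1)
  rw [← hY0] at h ⊢
  obtain ⟨h1, h2⟩ := padicValNat_choose_split_le (Y₁ := 2 ^ w) (K₁ := 0) (by omega) (by omega) h
  have h3 : 2 ^ (w + 1) * K₂ ≤ 2 ^ (w + 1) * Y₂ := Nat.mul_le_mul_left _ h1
  obtain ⟨h4, h5⟩ := padicValNat_choose_split_le (u := w + 1) (Y₁ := 0) (K₁ := 0)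
    (by positivity) le_rfl h3
  rw [Nat.add_sub_cancel]
  refine ⟨h3, ?_⟩
  simp only [add_zero, Nat.choose_zero_right] at h2 h5
  omega

/-! ### Divisibility of C(n-1-m,m) by 2. -/

/-- Absorption reduces the parity question to comparing ν(m) with ν(n-2m). -/
theorem choose_pred_sub_mul (n m : ℕ) (hm : 0 < m) :
    (n - 1 - m).choose m * m = (n - 1 - m).choose (m - 1) * (n - 2 * m) := by
  obtain ⟨k, rfl⟩ := Nat.exists_eq_add_of_lt hm
  rw [zero_add, Nat.add_sub_cancel, Nat.choose_succ_right_eq]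
  congr 1
  omega

/-- If i = ν(m) < v, then 2^(i+1) divides both n and 2m, hence n-2m. -/
theorem one_le_padicValNat_choose {n m v : ℕ} (hn : 2 ^ v ∣ n) (hm : ¬ 2 ^ v ∣ m)
    (h2 : 2 * m < n) : 1 ≤ padicValNat 2 ((n - 1 - m).choose m) := by
  have hm0 : m ≠ 0 := by rintro rfl; simp at hm
  have hc : (n - 1 - m).choose m ≠ 0 := (Nat.choose_pos (by omega)).ne'
  have hc' : (n - 1 - m).choose (m - 1) ≠ 0 := (Nat.choose_pos (by omega)).ne'
  have h := congrArg (padicValNat 2) (choose_pred_sub_mul n m (by omega))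
  rw [padicValNat.mul hc hm0, padicValNat.mul hc' (by omega)] at h
  set i := padicValNat 2 m
  have hi : i < v := by
    by_contra hcon
    exact hm ((pow_dvd_pow 2 (by omega)).trans pow_padicValNat_dvd)
  have h3 : i + 1 ≤ padicValNat 2 (n - 2 * m) := by
    rw [← padicValNat_dvd_iff_le (by omega)]
    refine Nat.dvd_sub ((pow_dvd_pow 2 hi).trans hn) ?_
    rw [pow_succ, mul_comm]
    exact mul_dvd_mul_left 2 pow_padicValNat_dvd
  omega

/-- Here n and 2m are both odd multiples of 2^(w+1), so their difference gains a further factor 2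
and exceeds ν(m) = w by two. -/
theorem two_le_padicValNat_choose {n m w : ℕ} (hn : n % 2 ^ (w + 2) = 2 ^ (w + 1))
    (hm : m % 2 ^ (w + 1) = 2 ^ w) (h2 : 2 * m < n) :
    2 ≤ padicValNat 2 ((n - 1 - m).choose m) := by
  have hm0 : m ≠ 0 := by
    rintro rfl
    have : 0 < 2 ^ w := by positivity
    rw [Nat.zero_mod] at hm
    omega
  have hc : (n - 1 - m).choose m ≠ 0 := (Nat.choose_pos (by omega)).ne'
  have hc' : (n - 1 - m).choose (m - 1) ≠ 0 := (Nat.choose_pos (by omega)).ne'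
  have h := congrArg (padicValNat 2) (choose_pred_sub_mul n m (by omega))
  rw [padicValNat.mul hc hm0, padicValNat.mul hc' (by omega)] at h
  have hw : 0 < 2 ^ w := by positivity
  have e1 : 2 ^ (w + 1) = 2 * 2 ^ w := by ring
  have e2 : 2 ^ (w + 2) = 4 * 2 ^ w := by ring
  have d1 := Nat.div_add_mod m (2 ^ (w + 1))
  have d2 := Nat.div_add_mod n (2 ^ (w + 2))
  rw [hm, e1] at d1
  rw [hn, e1, e2] at d2
  have h3 : w + 2 ≤ padicValNat 2 (n - 2 * m) := by
    rw [← padicValNat_dvd_iff_le (by omega), ← d1, ← d2]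
    refine ⟨n / (4 * 2 ^ w) - m / (2 * 2 ^ w), ?_⟩
    rw [e2, Nat.mul_sub]
    have : 2 * (2 * 2 ^ w * (m / (2 * 2 ^ w)) + 2 ^ w) =
      4 * 2 ^ w * (m / (2 * 2 ^ w)) + 2 * 2 ^ w := by ring
    rw [this]
    omega
  have h4 : padicValNat 2 m < w + 1 := by
    by_contra hcon
    have : 2 ^ (w + 1) ∣ m := (pow_dvd_pow 2 (by omega)).trans pow_padicValNat_dvd
    rw [Nat.dvd_iff_mod_eq_zero] at this
    omega
  omega

/-! ### The numerical hypotheses and their consequences for digits. -/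

/-- The numerical hypotheses, with `r = 2 ^ (e + 1) - n` and `q = p + ε * 2 ^ (ν(n) - 1)`. -/
structure ZeroData (e n r p q : ℕ) : Prop where
  add_eq : n + r = 2 ^ (e + 1)
  r_pos : 0 < r
  add_lt : r + p < 2 ^ (e - 1)
  add_two_mul_le : r + 2 * p ≤ 2 ^ (e - 1)
  exceptional : p ≠ 0 ∨ 1 < r
  odd : padicValNat 2 ((n - 1 - p).choose p) = 0
  q_eq : q = p ∨ ∃ w, n % 2 ^ (w + 2) = 2 ^ (w + 1) ∧ q = p + 2 ^ w

/-- The pairs `(j, k)` at which the minimal valuation is attained. -/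
def MinimalPair (e l p δ j k : ℕ) : Prop :=
  (j + 2 ^ l = 2 ^ e ∧ k = p) ∨
    (δ = 1 ∧ ((j + 2 ^ l = 2 ^ (e - 1) ∧ k = 2 ^ (e - 1) + p) ∨
      (j = 2 ^ (e - 1) ∧ k + 2 ^ l = 2 ^ (e - 1) + p)))

theorem binOnes_mod_le (a x : ℕ) : binOnes (x % 2 ^ a) ≤ binOnes x := by
  have := binOnes_div_add_mod a x
  omega

theorem binOnes_div_le (a x : ℕ) : binOnes (x / 2 ^ a) ≤ binOnes x := by
  have := binOnes_div_add_mod a x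
  omega

/-- Additivity of digit sums means that a and b share no digit 1, so their addition has no carry. -/
theorem add_lt_two_pow_of_odd_choose {l a b : ℕ} (ha : a < 2 ^ (l + 1)) (hb : 2 ^ l ≤ b)
    (hb' : b < 2 ^ (l + 1)) (h : binOnes (a + b) = binOnes a + binOnes b) :
    a < 2 ^ l ∧ a + b < 2 ^ (l + 1) := by
  have hs : 2 ^ (l + 1) = 2 * 2 ^ l := by ring
  obtain ⟨b₁, rfl⟩ := Nat.exists_eq_add_of_le hb
  rw [binOnes_two_pow_add (by omega)] at h
  have key : a < 2 ^ l := by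
    by_contra hc
    obtain ⟨a₁, rfl⟩ := Nat.exists_eq_add_of_le (not_lt.1 hc)
    rw [binOnes_two_pow_add (by omega)] at h
    have e1 : 2 ^ l + a₁ + (2 ^ l + b₁) = 2 ^ (l + 1) + (a₁ + b₁) := by omega
    have := binOnes_add_le a₁ b₁
    have := binOnes_add_le (2 ^ (l + 1)) (a₁ + b₁)
    rw [e1] at h
    rw [binOnes_two_pow] at this
    omega
  refine ⟨key, ?_⟩
  by_contra hc
  obtain ⟨d, hd⟩ := Nat.exists_eq_add_of_le (not_lt.1 hc)
  have h1 : a + b₁ = 2 ^ l + d := by omega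
  have h2 : a + (2 ^ l + b₁) = 2 ^ (l + 1) + d := by omega
  have h3 := binOnes_add_le a b₁
  rw [h2, binOnes_two_pow_add (by omega)] at h
  rw [h1, binOnes_two_pow_add (by omega)] at h3
  omega

theorem binOnes_two_pow_sub_add {e w p : ℕ} (hw : w ≤ e) (hp : p < 2 ^ w) {m : ℕ}
    (hm : m + 2 ^ w = 2 ^ e + p) : binOnes m = e - w + binOnes p := by
  obtain ⟨d, rfl⟩ := Nat.exists_eq_add_of_le hw
  have h1 : 1 ≤ 2 ^ d := Nat.one_le_two_pow
  have h2 : m = 2 ^ w * (2 ^ d - 1) + p := by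
    rw [pow_add] at hm
    rw [Nat.mul_sub]
    have := Nat.mul_le_mul_left (2 ^ w) h1
    omega
  have h3 := binOnes_compl (a := d) (z := 0) (by positivity)
  rw [binOnes_zero, Nat.sub_zero] at h3
  rw [h2, binOnes_pow_mul_add _ _ hp]
  omega

namespace ZeroData

variable {e n r p q : ℕ}

theorem two_le (h : ZeroData e n r p q) : 2 ≤ e := by
  by_contra hc
  have h1 : e - 1 = 0 := by omega
  have := h.add_lt
  have := h.r_pos
  rw [h1] at *
  omega

theorem two_pow_e (h : ZeroData e n r p q) : 2 ^ e = 2 * 2 ^ (e - 1) := by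
  have := h.two_le
  rw [← pow_succ']
  congr 1
  omega

theorem two_pow_e_succ (h : ZeroData e n r p q) : 2 ^ (e + 1) = 4 * 2 ^ (e - 1) := by
  have := h.two_pow_e
  rw [pow_succ]
  omega

/-- n-1-p and n-1-2p are the complements of r+p and r+2p in 2^(e+1)-1. Complementing Kummer's
formula turns the oddness of C(n-1-p,p) into disjointness of the digits of r+p and p. -/
theorem binOnes_add (h : ZeroData e n r p q) :
    binOnes (r + 2 * p) = binOnes (r + p) + binOnes p := by
  have h1 := h.add_eq
  have h2 := h.add_two_mul_le
  have h3 := h.two_pow_e_succ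
  have hr := h.r_pos
  have h4 := binOnes_choose (n := n - 1 - p) (k := p) (by omega)
  rw [h.odd] at h4
  have h5 := binOnes_compl (a := e + 1) (z := r + p) (by omega)
  have h6 := binOnes_compl (a := e + 1) (z := r + 2 * p) (by omega)
  have h7 : n - 1 - p = 2 ^ (e + 1) - 1 - (r + p) := by omega
  have h8 : n - 1 - p - p = 2 ^ (e + 1) - 1 - (r + 2 * p) := by omega
  rw [h8, h7] at h4
  omega

theorem log_spec (h : ZeroData e n r p q) :
    2 ^ Nat.log 2 (r + p) ≤ r + p ∧ r + 2 * p < 2 ^ (Nat.log 2 (r + p) + 1) ∧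
      p < 2 ^ Nat.log 2 (r + p) ∧ Nat.log 2 (r + p) + 1 < e := by
  have hr := h.r_pos
  have h1 := Nat.pow_log_le_self 2 (x := r + p) (by omega)
  have h2 := Nat.lt_pow_succ_log_self (b := 2) (by norm_num) (r + p)
  set l := Nat.log 2 (r + p)
  have h3 : binOnes (p + (r + p)) = binOnes p + binOnes (r + p) := by
    rw [show p + (r + p) = r + 2 * p by ring, h.binOnes_add, add_comm]
  have h4 := add_lt_two_pow_of_odd_choose (by omega) h1 h2 h3
  refine ⟨h1, by omega, h4.1, ?_⟩
  have h5 : 2 ^ l < 2 ^ (e - 1) := lt_of_le_of_lt h1 h.add_lt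
  have := (Nat.pow_lt_pow_iff_right (by norm_num : 1 < 2)).1 h5
  omega

/-- This is the case ε = 1, with ν(n) = w+1. Were p not divisible by 2^(w+1), C(n-1-p,p) would be
even; divisibility then passes to r. The last bound holds because distinct multiples of 2^(w+1)
differ by at least that much. -/
theorem dvd_of_twist (h : ZeroData e n r p q) {w : ℕ} (hw : n % 2 ^ (w + 2) = 2 ^ (w + 1)) :
    2 ^ (w + 1) ∣ n ∧ 2 ^ (w + 1) ∣ p ∧ 2 ^ (w + 1) ∣ r ∧ w + 2 < e ∧
      r + p + 2 ^ (w + 1) ≤ 2 ^ (e - 1) := by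
  have hr := h.r_pos
  have h1 := h.add_eq
  have h2 := h.add_two_mul_le
  have h3 := h.two_pow_e_succ
  have hn : 2 ^ (w + 1) ∣ n := by
    have hd := Nat.div_add_mod n (2 ^ (w + 2))
    rw [hw] at hd
    rw [← hd]
    exact dvd_add ((pow_dvd_pow 2 (by omega)).mul_right _) dvd_rfl
  have hp : 2 ^ (w + 1) ∣ p := by
    by_contra hc
    have := one_le_padicValNat_choose hn hc (by omega)
    have := h.odd
    omega
  have hr' : 2 ^ (w + 1) ∣ r := by
    have hle := Nat.le_of_dvd (by omega) hn
    have hlt : 2 ^ (w + 1) < 2 ^ (e + 1) := by omega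
    have := (Nat.pow_lt_pow_iff_right (by norm_num : 1 < 2)).1 hlt
    have h4 : 2 ^ (w + 1) ∣ n + r := by
      rw [h1]
      exact pow_dvd_pow 2 (by omega)
    exact (Nat.dvd_add_right hn).1 h4
  have hle := Nat.le_of_dvd hr hr'
  have hlt : 2 ^ (w + 1) < 2 ^ (e - 1) := by have := h.add_lt; omega
  have h5 := (Nat.pow_lt_pow_iff_right (by norm_num : 1 < 2)).1 hlt
  have h6 : 2 ^ (w + 1) ∣ 2 ^ (e - 1) - (r + p) :=
    Nat.dvd_sub (pow_dvd_pow 2 (by omega)) (dvd_add hr' hp)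
  have h7 := Nat.le_of_dvd (by have := h.add_lt; omega) h6
  have := h.add_lt
  exact ⟨hn, hp, hr', by omega, by omega⟩

theorem q_lt (h : ZeroData e n r p q) : q < 2 ^ (e - 1) := by
  rcases h.q_eq with rfl | ⟨w, hw, rfl⟩
  · have := h.add_lt
    omega
  · have h1 := (h.dvd_of_twist hw).2.2.2.2
    rw [pow_succ] at h1
    have : 0 < 2 ^ w := by positivity
    omega

theorem q_mod (h : ZeroData e n r p q) {w : ℕ} (hw : n % 2 ^ (w + 2) = 2 ^ (w + 1))
    (hq : q = p + 2 ^ w) : q % 2 ^ (w + 1) = 2 ^ w ∧ q / 2 ^ (w + 1) = p / 2 ^ (w + 1) := by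
  obtain ⟨t, rfl⟩ := (h.dvd_of_twist hw).2.1
  have h1 : 2 ^ w < 2 ^ (w + 1) := by
    rw [pow_succ]
    have : 0 < 2 ^ w := by positivity
    omega
  rw [hq]
  refine ⟨?_, ?_⟩
  · rw [Nat.mul_add_mod, Nat.mod_eq_of_lt h1]
  · rw [Nat.mul_add_div (by positivity), Nat.div_eq_of_lt h1, Nat.mul_div_cancel_left _
      (by positivity)]
    rfl

/-! ### The weight inequalities. -/

/-- The low digits of k are paid for by ν(C(Y,k)) and the digits of q. When q = p+2^w this may fall
one short, but only if the low w+1 digits of k are those of 2^w; otherwise they already contribute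
to the binomial coefficient. -/
theorem binOnes_mod_le (h : ZeroData e n r p q) {u k Y : ℕ} (hu : u < e) (hk : k ≤ Y)
    (hY : Y % 2 ^ (e - 1) = q) :
    binOnes (k % 2 ^ u) ≤ padicValNat 2 (Y.choose k) + binOnes p ∨
      ∃ w, n % 2 ^ (w + 2) = 2 ^ (w + 1) ∧ q = p + 2 ^ w ∧ w + 1 ≤ u ∧
        k % 2 ^ (w + 1) = 2 ^ w ∧
        binOnes (k % 2 ^ u) ≤ padicValNat 2 (Y.choose k) + binOnes p + 1 := by
  have hYq (t : ℕ) (ht : t < e) : Y % 2 ^ t = q % 2 ^ t := by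
    rw [← hY, Nat.mod_mod_of_dvd _ (pow_dvd_pow 2 (by omega))]
  have h1 := binOnes_mod_le_choose u hk
  rw [hYq u hu] at h1
  rcases h.q_eq with rfl | ⟨w, hw, hq⟩
  · left
    have := _root_.binOnes_mod_le u q
    omega
  · obtain ⟨hn, hp, hr, hwe, -⟩ := h.dvd_of_twist hw
    have hqm := h.q_mod hw hq
    rcases Nat.lt_or_ge u (w + 1) with huw | huw
    · left
      have h2 : q % 2 ^ u = 0 := by
        rw [hq, ← Nat.dvd_iff_mod_eq_zero]
        exact dvd_add ((pow_dvd_pow 2 (by omega)).trans hp) (pow_dvd_pow 2 (by omega))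
      rw [h2, binOnes_zero] at h1
      omega
    · by_cases hkw : k % 2 ^ (w + 1) = 2 ^ w
      · right
        refine ⟨w, hw, hq, huw, hkw, ?_⟩
        have h2 := _root_.binOnes_mod_le u q
        have h3 := binOnes_add_le p (2 ^ w)
        rw [← hq, binOnes_two_pow] at h3
        omega
      · left
        obtain ⟨h2, h3⟩ := binOnes_mod_add_choose_le hk (by rw [hYq _ (by omega), hqm.1]) hkw
        have h4 := binOnes_mod_le_choose (u - (w + 1)) h2
        have h5 (x : ℕ) : x / 2 ^ (w + 1) % 2 ^ (u - (w + 1)) = x % 2 ^ u / 2 ^ (w + 1) := by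
          rw [← Nat.mod_mul_right_div_self, ← pow_add]
          congr 3
          omega
        have h6 := binOnes_div_add_mod (w + 1) (k % 2 ^ u)
        rw [Nat.mod_mod_of_dvd _ (pow_dvd_pow 2 huw), ← h5] at h6
        rw [h5 Y, hYq u hu, ← h5 q, hqm.2] at h4
        have h7 := _root_.binOnes_mod_le (u - (w + 1)) (p / 2 ^ (w + 1))
        have h8 := binOnes_div_le (w + 1) p
        omega

theorem weight_lt_of_lt (h : ZeroData e n r p q) {j k Y m : ℕ} (hj : 0 < j) (hk : k ≤ Y)
    (hY : Y % 2 ^ (e - 1) = q) (hm : m < j + k) (hmn : 2 * m < n) :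
    padicValNat 2 j + min (binOnes m) (binOnes (j + k)) + m <
      padicValNat 2 (Y.choose k) + e + (j + k) + binOnes p +
        padicValNat 2 ((n - 1 - m).choose m) := by
  have hpe := h.two_pow_e
  have hpe' := h.two_pow_e_succ
  have hsum := h.add_eq
  have hr := h.r_pos
  have he := h.two_le
  set u := padicValNat 2 j with hu
  obtain ⟨j', hj'⟩ : 2 ^ u ∣ j := pow_padicValNat_dvd
  have hj'0 : 0 < j' := by
    rcases Nat.eq_zero_or_pos j' with rfl | h0
    · omega
    · exact h0
  have hup : 0 < 2 ^ u := by positivity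
  rcases Nat.lt_or_ge u e with hue | hue
  · have hs := binOnes_div_add_mod u (j + k)
    have hmod : (j + k) % 2 ^ u = k % 2 ^ u := by rw [hj', Nat.mul_add_mod]
    rw [hmod] at hs
    have hb := h.binOnes_mod_le hue hk hY
    have hee : 2 ^ e = 2 ^ u * 2 ^ (e - u) := by rw [← pow_add]; congr 1; omega
    rcases Nat.lt_or_ge (j + k) (2 ^ e) with hse | hse
    · have h1 : binOnes ((j + k) / 2 ^ u) ≤ e - u := by
        refine binOnes_le_of_lt (Nat.div_lt_of_lt_mul ?_)
        rwa [← hee]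
      rcases hb with hb | ⟨w, hw, hq, hwu, hkw, hb⟩
      · have := min_le_right (binOnes m) (binOnes (j + k))
        omega
      · by_cases hcN : 1 ≤ padicValNat 2 ((n - 1 - m).choose m)
        · have := min_le_right (binOnes m) (binOnes (j + k))
          omega
        · by_cases hms : m + 1 < j + k
          · have := min_le_right (binOnes m) (binOnes (j + k))
            omega
          -- The one remaining deficit: oddness of C(n-1-m,m) makes m even, so m = j+k-1 has one
          -- digit 1 fewer than j+k, and the minimum recovers the unit.
          · have hms' : j + k = m + 1 := by omega
            obtain ⟨hn, -⟩ := h.dvd_of_twist hw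
            have hdm : 2 ^ (w + 1) ∣ m := by
              by_contra hc
              exact hcN (one_le_padicValNat_choose hn hc hmn)
            obtain ⟨z, hz⟩ := (Dvd.intro_left (2 ^ w) (pow_succ 2 w).symm).trans hdm
            have h2 : binOnes (j + k) = binOnes m + 1 := by
              rw [hms', hz, binOnes_two_mul_add_one, binOnes_two_mul]
            have := min_le_left (binOnes m) (binOnes (j + k))
            omega
    · have hmin := min_le_right (binOnes m) (binOnes (j + k))
      -- The excess t adds at most t to the digit sum but at least t to j+k itself.
      obtain ⟨t, ht⟩ : ∃ t, (j + k) / 2 ^ u = 2 ^ (e - u) + t := by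
        refine Nat.exists_eq_add_of_le ?_
        rw [Nat.le_div_iff_mul_le hup, mul_comm, ← hee]
        exact hse
      have h1 := binOnes_add_le (2 ^ (e - u)) t
      rw [← ht, binOnes_two_pow] at h1
      have h2 := binOnes_le t
      have h3 := Nat.mul_div_le (j + k) (2 ^ u)
      rw [ht, mul_add, ← hee] at h3
      have h4 : t ≤ 2 ^ u * t := Nat.le_mul_of_pos_left _ hup
      rcases hb with hb | ⟨w, hw, hq, hwu, hkw, hb⟩
      · omega
      · obtain ⟨hn, -⟩ := h.dvd_of_twist hw
        -- For even n the bounds 2m < n < 2^(e+1) leave m ≤ 2^e-2, which makes up for the unit lost.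
        have hdn : 2 ∣ n := (Dvd.intro_left (2 ^ w) (pow_succ 2 w).symm).trans hn
        omega
  · have hmin := min_le_right (binOnes m) (binOnes (j + k))
    have h1 := binOnes_add_le j k
    have h2 := binOnes_le k
    have h3 := binOnes_le j'
    have h4 : binOnes j = binOnes j' := by rw [hj', binOnes_pow_mul]
    -- The excluded pair (n,p) = (2^(e+1)-1,0) would break this bound at m = 2^e-1.
    have h5 : m + 2 ≤ 2 ^ e + binOnes p := by
      rcases h.exceptional with hp | hr1
      · have := binOnes_pos (z := p) (by omega)
        omega
      · omega
    obtain ⟨d, hd⟩ := Nat.exists_eq_add_of_le hue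
    have h6 : 2 ^ e + d ≤ 2 ^ u := by
      rw [hd, pow_add]
      have h7 : d + 1 ≤ 2 ^ d := Nat.lt_two_pow_self
      have h8 : 2 ^ e * (d + 1) ≤ 2 ^ e * 2 ^ d := Nat.mul_le_mul_left _ h7
      have h9 : d ≤ 2 ^ e * d := Nat.le_mul_of_pos_left _ (by positivity)
      rw [mul_add] at h8
      omega
    have h7 : 2 ^ u + (j' - 1) ≤ 2 ^ u * j' := by
      obtain ⟨i, hi⟩ := Nat.exists_eq_add_of_lt hj'0
      have h8 : 2 ^ u * j' = 2 ^ u * i + 2 ^ u := by rw [hi]; ring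
      have h9 : i ≤ 2 ^ u * i := Nat.le_mul_of_pos_left _ hup
      omega
    omega

/-- Here m = j+k. The bound is a sum of separate estimates above and below position ν(j), so
equality forces equality in each. -/
theorem weight_le (h : ZeroData e n r p q) {j k Y : ℕ} (hj : 0 < j) (hk : k ≤ Y)
    (hY : Y % 2 ^ (e - 1) = q) (hmn : 2 * (j + k) < n) :
    padicValNat 2 j + binOnes (j + k) ≤
      padicValNat 2 (Y.choose k) + e + binOnes p +
        padicValNat 2 ((n - 1 - (j + k)).choose (j + k)) ∧
    (padicValNat 2 j + binOnes (j + k) =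
      padicValNat 2 (Y.choose k) + e + binOnes p +
        padicValNat 2 ((n - 1 - (j + k)).choose (j + k)) →
      padicValNat 2 j < e ∧ binOnes ((j + k) / 2 ^ padicValNat 2 j) = e - padicValNat 2 j ∧
      padicValNat 2 ((n - 1 - (j + k)).choose (j + k)) = 0 ∧
      binOnes (k % 2 ^ padicValNat 2 j) = padicValNat 2 (Y.choose k) + binOnes p) := by
  have hpe := h.two_pow_e
  have hpe' := h.two_pow_e_succ
  have hsum := h.add_eq
  set u := padicValNat 2 j with hu
  have hjd : 2 ^ u ∣ j := pow_padicValNat_dvd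
  have hue : u < e := by
    by_contra hc
    have h1 := Nat.le_of_dvd hj ((pow_dvd_pow 2 (not_lt.1 hc)).trans hjd)
    omega
  obtain ⟨j', hj'⟩ := hjd
  have hs := binOnes_div_add_mod u (j + k)
  have hmod : (j + k) % 2 ^ u = k % 2 ^ u := by
    conv_lhs => rw [hj', Nat.mul_add_mod]
  rw [hmod] at hs
  have hee : 2 ^ e = 2 ^ u * 2 ^ (e - u) := by rw [← pow_add]; congr 1; omega
  have h1 : binOnes ((j + k) / 2 ^ u) ≤ e - u := by
    refine binOnes_le_of_lt (Nat.div_lt_of_lt_mul ?_)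
    rw [← hee]
    omega
  rcases h.binOnes_mod_le hue hk hY with hb | ⟨w, hw, hq, hwu, hkw, hb⟩
  · exact ⟨by omega, fun _ => by omega⟩
  · have hm : (j + k) % 2 ^ (w + 1) = 2 ^ w := by
      have h2 := congrArg (· % 2 ^ (w + 1)) hmod
      simp only [Nat.mod_mod_of_dvd _ (pow_dvd_pow 2 hwu)] at h2
      rw [h2, hkw]
    -- The deficit of one is outweighed by two factors 2, so this case never gives equality.
    have := two_le_padicValNat_choose hw hm hmn
    exact ⟨by omega, fun _ => by omega⟩

/-- The bound 2m < n gives r+2p < 2^(w+1). If 2^w > r+p, Kummer's formula together with additivity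
of the digit sums of r+p and p would yield w = e. -/
theorem eq_log (h : ZeroData e n r p q) {w m : ℕ} (hw : w < e) (hp : p < 2 ^ w)
    (hm : m + 2 ^ w = 2 ^ e + p) (hmn : 2 * m < n)
    (hc : padicValNat 2 ((n - 1 - m).choose m) = 0) : w = Nat.log 2 (r + p) := by
  have hsum := h.add_eq
  have hr := h.r_pos
  have h1 : 2 ^ (e + 1) = 2 * 2 ^ e := by ring
  have h2 : 2 ^ (w + 1) = 2 * 2 ^ w := by ring
  have hle : 2 ^ w ≤ r + p := by
    by_contra hlt
    have e1 := binOnes_choose (n := n - 1 - m) (k := m) (by omega)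
    rw [hc, binOnes_two_pow_sub_add hw.le hp hm] at e1
    have e2 : n - 1 - m = 2 ^ e + (2 ^ w - 1 - (r + p)) := by omega
    have e3 : n - 1 - m - m = 2 ^ (w + 1) - 1 - (r + 2 * p) := by omega
    have hwe : 2 ^ w ≤ 2 ^ e := Nat.pow_le_pow_right (by norm_num) hw.le
    have e4 := binOnes_compl (a := w) (z := r + p) (by omega)
    have e5 := binOnes_compl (a := w + 1) (z := r + 2 * p) (by omega)
    rw [e3, e2, binOnes_two_pow_add (by omega)] at e1
    have := h.binOnes_add
    omega
  symm
  exact (Nat.log_eq_iff (Or.inr ⟨by norm_num, by omega⟩)).2 ⟨hle, by omega⟩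

theorem padicValNat_choose_eq_zero (h : ZeroData e n r p q) {m : ℕ}
    (hm : m + 2 ^ Nat.log 2 (r + p) = 2 ^ e + p) :
    2 * m < n ∧ padicValNat 2 ((n - 1 - m).choose m) = 0 := by
  obtain ⟨h1, h2, h3, h4⟩ := h.log_spec
  set l := Nat.log 2 (r + p)
  have hsum := h.add_eq
  have hr := h.r_pos
  have e0 : 2 ^ (e + 1) = 2 * 2 ^ e := by ring
  have e0' : 2 ^ (l + 1) = 2 * 2 ^ l := by ring
  have hmn : 2 * m < n := by omega
  refine ⟨hmn, ?_⟩
  have e1 := binOnes_choose (n := n - 1 - m) (k := m) (by omega)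
  rw [binOnes_two_pow_sub_add (by omega) h3 hm] at e1
  have e3 : n - 1 - m - m = 2 ^ (l + 1) - 1 - (r + 2 * p) := by omega
  have e5 := binOnes_compl (a := l + 1) (z := r + 2 * p) (by omega)
  have e4 := binOnes_compl (a := l + 1) (z := r + p) (by omega)
  have hle : 2 ^ (l + 1) ≤ 2 ^ e := Nat.pow_le_pow_right (by norm_num) (by omega)
  have e6 : n - 1 - m + 2 ^ l = 2 ^ e + (2 ^ (l + 1) - 1 - (r + p)) := by omega
  have e7 := binOnes_two_pow_sub_add (e := e) (w := l) (by omega) (by omega) e6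
  rw [e3] at e1
  have := h.binOnes_add
  omega

end ZeroData

/-! ### The pairs attaining the minimal weight. -/

namespace ZeroData

variable {e n r p q : ℕ}

theorem exists_untwisted (h : ZeroData e n r p q) {δ k Y : ℕ} (hδ : δ ≤ 1) (hk : k ≤ Y)
    (hY : Y % 2 ^ e = q + δ * 2 ^ (e - 1))
    (hdvd : ∀ w, n % 2 ^ (w + 2) = 2 ^ (w + 1) → q = p + 2 ^ w → 2 ^ (w + 1) ∣ k) :
    ∃ Y', k ≤ Y' ∧ Y' % 2 ^ e = p + δ * 2 ^ (e - 1) ∧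
      padicValNat 2 (Y.choose k) = padicValNat 2 (Y'.choose k) := by
  rcases h.q_eq with rfl | ⟨w, hw, hq⟩
  · exact ⟨Y, hk, hY, rfl⟩
  · have hwe := (h.dvd_of_twist hw).2.2.2.1
    have hqm := (h.q_mod hw hq).1
    have hd := Nat.div_add_mod Y (2 ^ e)
    rw [hY] at hd
    have hd1 : 2 ^ (w + 1) ∣ 2 ^ e := pow_dvd_pow 2 (by omega)
    have hd2 : 2 ^ (w + 1) ∣ δ * 2 ^ (e - 1) := (pow_dvd_pow 2 (by omega)).mul_left _
    have hYw : Y % 2 ^ (w + 1) = 2 ^ w := by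
      rw [← Nat.mod_mod_of_dvd Y hd1, hY, Nat.add_mod, Nat.mod_eq_zero_of_dvd hd2, add_zero,
        Nat.mod_mod, hqm]
    obtain ⟨h1, h2⟩ := padicValNat_choose_sub_two_pow hk hYw (hdvd w hw hq)
    refine ⟨Y - 2 ^ w, h1, ?_, h2⟩
    have h3 : Y - 2 ^ w = 2 ^ e * (Y / 2 ^ e) + (p + δ * 2 ^ (e - 1)) := by omega
    have h4 := h.q_lt
    have h5 := h.two_pow_e
    rw [h3, Nat.mul_add_mod, Nat.mod_eq_of_lt]
    have : δ * 2 ^ (e - 1) ≤ 1 * 2 ^ (e - 1) := Nat.mul_le_mul_right _ hδ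
    omega

/-- Cut at u = ν(j), with e = u+a+1; the upper digits of j+k are all 1. Without a borrow, equality
forces k₀ = p and C(Y₂,k₂) odd, whence k₂ is 0 or 2^a: the first two kinds of pairs. With a borrow,
2^u+p-k₀ is a power of 2 and Y₂-k₂ is odd, which forces a = 0 and the third kind. -/
theorem minimalPair_of_untwisted (h : ZeroData e n r p q) {δ j k Y : ℕ} (hδ : δ ≤ 1)
    (hj : 0 < j) (hk : k ≤ Y) (hY : Y % 2 ^ e = p + δ * 2 ^ (e - 1)) (hmn : 2 * (j + k) < n)
    (hu : padicValNat 2 j < e)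
    (h1 : binOnes ((j + k) / 2 ^ padicValNat 2 j) = e - padicValNat 2 j)
    (h2 : padicValNat 2 ((n - 1 - (j + k)).choose (j + k)) = 0)
    (h3 : binOnes (k % 2 ^ padicValNat 2 j) = padicValNat 2 (Y.choose k) + binOnes p) :
    MinimalPair e (Nat.log 2 (r + p)) p δ j k := by
  have hsum := h.add_eq
  have hlog := fun w => h.eq_log (w := w) (m := j + k)
  have hlt : j + k < 2 ^ e := by
    have : 2 ^ (e + 1) = 2 * 2 ^ e := by ring
    omega
  obtain ⟨j', hj'⟩ : 2 ^ padicValNat 2 j ∣ j := pow_padicValNat_dvd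
  have hodd : ¬ 2 ∣ j' := by
    rintro ⟨z, rfl⟩
    have hd : 2 ^ (padicValNat 2 j + 1) ∣ j := ⟨z, by rw [pow_succ, mul_assoc]; exact hj'⟩
    exact pow_succ_padicValNat_not_dvd hj.ne' hd
  generalize padicValNat 2 j = u at *
  obtain ⟨a, rfl⟩ := Nat.exists_eq_add_of_lt hu
  have he1 : u + a + 1 - 1 = u + a := by omega
  have hea : 2 ^ (u + a) = 2 ^ u * 2 ^ a := pow_add _ _ _
  have hea1 : 2 ^ (u + a + 1) = 2 ^ u * (2 * 2 ^ a) := by ring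
  have hup : 0 < 2 ^ u := by positivity
  have hap : 0 < 2 ^ a := by positivity
  unfold MinimalPair
  rw [he1] at hY ⊢
  have hYd := Nat.div_add_mod Y (2 ^ (u + a + 1))
  rw [hY] at hYd
  set t := Y / 2 ^ (u + a + 1)
  obtain ⟨Y₂, hY₂⟩ : ∃ Y₂, Y₂ = 2 * 2 ^ a * t + δ * 2 ^ a := ⟨_, rfl⟩
  have hYs : Y = 2 ^ u * Y₂ + p := by rw [← hYd, hY₂, hea, hea1]; ring
  -- The low digits of p alone suffice to pay for k, so equality leaves no digit of p above position
  -- u.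
  have hp : p < 2 ^ u := by
    have h4 := binOnes_mod_le_choose u hk
    have h5 : Y % 2 ^ u = p % 2 ^ u := by rw [hYs, Nat.mul_add_mod]
    have h6 := binOnes_div_add_mod u p
    rw [h5] at h4
    have h7 := binOnes_eq_zero (z := p / 2 ^ u) (by omega)
    rcases Nat.div_eq_zero_iff.1 h7 with h8 | h8
    · omega
    · exact h8
  have hkd := Nat.div_add_mod k (2 ^ u)
  have hk0 := Nat.mod_lt k hup
  set k₀ := k % 2 ^ u
  set k₂ := k / 2 ^ u
  have hjk : (j + k) / 2 ^ u = j' + k₂ := by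
    rw [hj', Nat.mul_add_div hup]
  clear_value k₂ k₀
  have hjk2 : j' + k₂ = 2 * 2 ^ a - 1 := by
    rw [hjk] at h1
    have h4 : j' + k₂ < 2 ^ (a + 1) := by
      rw [← hjk]
      refine Nat.div_lt_of_lt_mul ?_
      rw [← pow_add, ← add_assoc]
      exact hlt
    have h5 := eq_of_binOnes_eq h4 (by omega)
    rw [h5, pow_succ, mul_comm]
  have hm : j + k + 2 ^ u = 2 ^ (u + a + 1) + k₀ := by
    have h4 : 2 ^ u * (j' + k₂) + 2 ^ u = 2 ^ u * (2 * 2 ^ a) := by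
      rw [hjk2, Nat.mul_sub, mul_one, Nat.sub_add_cancel]
      exact Nat.le_mul_of_pos_right _ (by omega)
    rw [mul_add] at h4
    omega
  have hk' := hk
  rw [hYs, ← hkd] at hk'
  rw [hYs, ← hkd] at h3
  rcases le_or_gt k₀ p with hc | hc
  · obtain ⟨h4, h5⟩ := padicValNat_choose_split_le hp hc hk'
    have h6 := binOnes_choose hc
    have h7 := binOnes_eq_zero (z := p - k₀) (by omega)
    have h8 : k₀ = p := by omega
    have h9 : padicValNat 2 (Y₂.choose k₂) = 0 := by omega
    have hw := hlog u (by omega) hp (by omega) hmn h2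
    rw [← hw]
    rcases Nat.eq_zero_or_pos k₂ with hk2 | hk2
    · left
      rw [hk2] at hkd
      omega
    · right
      -- Absorption: since C(Y₂,k₂) is odd, the factor 2^a of Y₂ must divide k₂.
      have hck : Y₂.choose k₂ * k₂ = Y₂ * (Y₂ - 1).choose (k₂ - 1) := by
        have := Nat.add_one_mul_choose_eq (Y₂ - 1) (k₂ - 1)
        rw [Nat.sub_add_cancel hk2, Nat.sub_add_cancel (by omega)] at this
        omega
      have hv := congrArg (padicValNat 2) hck
      rw [padicValNat.mul (Nat.choose_pos h4).ne' hk2.ne', padicValNat.mul (by omega)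
        (Nat.choose_pos (by omega)).ne', h9] at hv
      have ha : a ≤ padicValNat 2 Y₂ := by
        rw [← padicValNat_dvd_iff_le (by omega), hY₂]
        exact dvd_add ((dvd_mul_left _ _).mul_right _) (dvd_mul_left _ _)
      have ha2 : 2 ^ a ∣ k₂ := (pow_dvd_pow 2 (by omega)).trans pow_padicValNat_dvd
      obtain ⟨z, hz⟩ := ha2
      have hz1 : z = 1 := by
        have hj0 : 0 < j' := by
          by_contra hc
          exact hodd ⟨0, by omega⟩
        have hz2 : z < 2 := by
          by_contra hc
          have := Nat.mul_le_mul_left (2 ^ a) (not_lt.1 hc)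
          omega
        have hz0 : z ≠ 0 := by rintro rfl; omega
        omega
      rw [hz1, mul_one] at hz
      have hδ1 : δ = 1 := by
        by_contra hne
        have hδ0 : δ = 0 := by omega
        have h10 : a + 1 ≤ padicValNat 2 Y₂ := by
          rw [← padicValNat_dvd_iff_le (by omega), hY₂, hδ0, zero_mul, add_zero, pow_succ,
            mul_comm (2 ^ a)]
          exact dvd_mul_right _ _
        rw [hz, padicValNat.prime_pow] at hv
        omega
      refine ⟨hδ1, Or.inl ?_⟩
      rw [hz] at hkd
      rw [hea]
      omega
  · obtain ⟨h4, h5⟩ := padicValNat_choose_split_lt hk0 hc hk'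
    have h6 := binOnes_pos (z := 2 ^ u + p - k₀) (by omega)
    obtain ⟨w, hw⟩ := eq_two_pow_of_binOnes_eq_one (z := 2 ^ u + p - k₀) (by omega)
    have hwu : w < u := by
      have : 2 ^ w < 2 ^ u := by omega
      exact (Nat.pow_lt_pow_iff_right (by norm_num)).1 this
    have hw' := hlog w (by omega) (by omega) (by omega) hmn h2
    rw [← hw']
    right
    have h7 : ¬ 2 ∣ Y₂ - k₂ := by
      intro hd
      have := (padicValNat_dvd_iff_le (p := 2) (n := 1) (a := Y₂ - k₂) (by omega)).1
        (by simpa using hd)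
      omega
    -- j' and j'+k₂ are odd, so k₂ is even; for a > 0 also Y₂ would be even, against `h7`.
    have ha0 : a = 0 := by
      by_contra ha
      obtain ⟨b, rfl⟩ := Nat.exists_eq_succ_of_ne_zero ha
      have h8 : Y₂ = 2 * (2 * 2 ^ b * t * 2 + δ * 2 ^ b) - 2 * (2 * 2 ^ b * t * 2) +
        2 * (2 * 2 ^ b * t) := by
        rw [hY₂, Nat.succ_eq_add_one, pow_succ]
        have : 2 * (2 * 2 ^ b * t * 2 + δ * 2 ^ b) - 2 * (2 * 2 ^ b * t * 2) =
          2 * (δ * 2 ^ b) := by rw [mul_add]; omega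
        rw [this]
        ring
      omega
    subst ha0
    rw [pow_zero] at hY₂ hjk2
    have hδ1 : δ = 1 := by omega
    refine ⟨hδ1, Or.inr ?_⟩
    have hj0 : 1 ≤ j' := by
      by_contra hc
      exact hodd ⟨0, by omega⟩
    have hk2 : k₂ = 0 := by omega
    have hj1 : j' = 1 := by omega
    rw [hk2] at hkd
    rw [hj1] at hj'
    rw [hea]
    omega

/-- Reduction to q = p, which needs 2^(w+1) ∣ k. Oddness of C(n-1-(j+k),j+k) gives 2^(w+1) ∣ j+k;
and ν(j) ≤ w is impossible, as the upper part of j+k would then be even instead of all ones. -/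
theorem minimalPair_of_weight_eq (h : ZeroData e n r p q) {δ j k Y : ℕ} (hδ : δ ≤ 1)
    (hj : 0 < j) (hk : k ≤ Y) (hY : Y % 2 ^ e = q + δ * 2 ^ (e - 1)) (hmn : 2 * (j + k) < n)
    (heq : padicValNat 2 j + binOnes (j + k) =
      padicValNat 2 (Y.choose k) + e + binOnes p +
        padicValNat 2 ((n - 1 - (j + k)).choose (j + k))) :
    MinimalPair e (Nat.log 2 (r + p)) p δ j k := by
  have he := h.two_le
  have hqlt := h.q_lt
  have hY' : Y % 2 ^ (e - 1) = q := by
    rw [← Nat.mod_mod_of_dvd Y (pow_dvd_pow 2 (by omega : e - 1 ≤ e)), hY,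
      Nat.add_mul_mod_self_right, Nat.mod_eq_of_lt hqlt]
  obtain ⟨hu, h1, h2, h3⟩ := (h.weight_le hj hk hY' hmn).2 heq
  obtain ⟨Y', hk', hYe, hc⟩ := h.exists_untwisted hδ hk hY (by
    intro w hw hq
    obtain ⟨hn, hp, -, hwe, -⟩ := h.dvd_of_twist hw
    have hm : 2 ^ (w + 1) ∣ j + k := by
      by_contra hc
      have := one_le_padicValNat_choose hn hc hmn
      omega
    have hj' : 2 ^ padicValNat 2 j ∣ j := pow_padicValNat_dvd
    rcases Nat.lt_or_ge (padicValNat 2 j) (w + 1) with hlt | hge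
    · exfalso
      have h4 := binOnes_mod_le_choose (padicValNat 2 j) hk
      have h5 : Y % 2 ^ padicValNat 2 j = 0 := by
        rw [← Nat.mod_mod_of_dvd Y (pow_dvd_pow 2 (by omega : padicValNat 2 j ≤ e - 1)), hY', hq]
        exact Nat.mod_eq_zero_of_dvd (dvd_add ((pow_dvd_pow 2 (by omega)).trans hp)
          (pow_dvd_pow 2 (by omega)))
      rw [h5, binOnes_zero] at h4
      have h6 : (j + k) / 2 ^ padicValNat 2 j < 2 ^ (e - padicValNat 2 j) := by
        refine Nat.div_lt_of_lt_mul ?_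
        rw [← pow_add, Nat.add_sub_cancel' hu.le]
        have := h.add_eq
        have : 2 ^ (e + 1) = 2 * 2 ^ e := by ring
        omega
      have h7 := eq_of_binOnes_eq h6 h1
      have h8 : 2 ∣ (j + k) / 2 ^ padicValNat 2 j := by
        obtain ⟨z, hz⟩ := (pow_dvd_pow 2 hlt).trans hm
        rw [hz, Nat.succ_eq_add_one, pow_succ, mul_assoc, Nat.mul_div_cancel_left _ (by positivity)]
        exact dvd_mul_right _ _
      obtain ⟨d, hd⟩ := Nat.exists_eq_add_of_lt hu
      have h9 : 2 ^ (e - padicValNat 2 j) = 2 * 2 ^ d := by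
        rw [← pow_succ']
        congr 1
        omega
      have : 0 < 2 ^ d := by positivity
      omega
    · exact (Nat.dvd_add_right ((pow_dvd_pow 2 hge).trans hj')).1 hm)
  rw [hc] at h3
  exact h.minimalPair_of_untwisted hδ hj hk' hYe hmn hu h1 h2 h3

/-- All three kinds share j+k = 2^e-2^l+p. In the first two ν(j) = l and C(Y,k) is odd; in the third
ν(j) = e-1 and ν(C(Y,k)) = e-1-l. -/
theorem weight_eq_of_minimalPair (h : ZeroData e n r p q) {δ j k Y : ℕ} (hδ : δ ≤ 1)
    (hj : 0 < j) (hk : k ≤ Y) (hY : Y % 2 ^ e = q + δ * 2 ^ (e - 1))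
    (hmp : MinimalPair e (Nat.log 2 (r + p)) p δ j k) :
    2 * (j + k) < n ∧ padicValNat 2 j + binOnes (j + k) =
      padicValNat 2 (Y.choose k) + e + binOnes p +
        padicValNat 2 ((n - 1 - (j + k)).choose (j + k)) := by
  obtain ⟨l1, l2, l3, l4⟩ := h.log_spec
  have hpe := h.two_pow_e
  have hple : 2 ^ Nat.log 2 (r + p) ≤ 2 ^ (e - 1) := Nat.pow_le_pow_right (by norm_num) (by omega)
  have hm : j + k + 2 ^ Nat.log 2 (r + p) = 2 ^ e + p := by
    unfold MinimalPair at hmp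
    omega
  obtain ⟨hmn, hcN⟩ := h.padicValNat_choose_eq_zero hm
  refine ⟨hmn, ?_⟩
  rw [hcN, binOnes_two_pow_sub_add (by omega) l3 hm]
  obtain ⟨Y', hk', hYe, hc⟩ := h.exists_untwisted hδ hk hY (by
    intro w hw hq
    obtain ⟨hn, hp, hr, hwe, -⟩ := h.dvd_of_twist hw
    have hwl : w + 1 ≤ Nat.log 2 (r + p) :=
      Nat.le_log_of_pow_le (by norm_num)
        (Nat.le_of_dvd (by have := h.r_pos; omega) (dvd_add hr hp))
    have h1 : 2 ^ (w + 1) ∣ 2 ^ Nat.log 2 (r + p) := pow_dvd_pow 2 hwl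
    have h2 : 2 ^ (w + 1) ∣ 2 ^ (e - 1) := pow_dvd_pow 2 (by omega)
    rcases hmp with ⟨-, hkp⟩ | ⟨-, ⟨-, hkp⟩ | ⟨-, hkp⟩⟩
    · rwa [hkp]
    · rw [hkp]
      exact dvd_add h2 hp
    · have h3 : k = 2 ^ (e - 1) + p - 2 ^ Nat.log 2 (r + p) := by omega
      rw [h3]
      exact Nat.dvd_sub (dvd_add h2 hp) h1)
  rw [hc]
  generalize Nat.log 2 (r + p) = l at *
  have hYd := Nat.div_add_mod Y' (2 ^ e)
  rw [hYe] at hYd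
  have hep : 0 < 2 ^ (e - 1) := by positivity
  generalize Y' / 2 ^ e = T at *
  have hYs : 2 ^ (e - 1) * (2 * T + δ) + p = Y' := by
    rw [← hYd, hpe]
    ring
  rcases hmp with ⟨hjl, hkp⟩ | ⟨hδ1, ⟨hjl, hkp⟩ | ⟨hjl, hkp⟩⟩
  · have hu : padicValNat 2 j = l := by
      obtain ⟨d, hd⟩ := Nat.exists_eq_add_of_lt l4
      have h1 : j = 2 ^ l * (2 * (2 * 2 ^ d - 1) + 1) := by
        have h2 : 2 ^ e = 2 ^ l * (4 * 2 ^ d) := by rw [hd]; ring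
        have h3 : 2 * (2 * 2 ^ d - 1) + 1 + 1 = 4 * 2 ^ d := by
          have : 0 < 2 ^ d := by positivity
          omega
        rw [← h3, mul_add, mul_one] at h2
        omega
      rw [h1, padicValNat.mul (by positivity) (by omega), padicValNat.prime_pow,
        padicValNat.eq_zero_of_not_dvd (by omega), add_zero]
    have hY1 : 2 ^ (e - 1) * 0 + p ≤ 2 ^ (e - 1) * (2 * T + δ) + p := by omega
    have h1 := padicValNat_choose_split_le (u := e - 1) (by omega) le_rfl hY1
    rw [hYs, mul_zero, zero_add, ← hkp, Nat.choose_self, Nat.choose_zero_right, padicValNat_one_right]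
      at h1
    omega
  · have hu : padicValNat 2 j = l := by
      obtain ⟨d, hd⟩ := Nat.exists_eq_add_of_lt l4
      have h1 : j = 2 ^ l * (2 * (2 ^ d - 1) + 1) := by
        have h2 : 2 ^ (e - 1) = 2 ^ l * (2 * 2 ^ d) := by
          rw [hd, Nat.add_sub_cancel]
          ring
        have h3 : 2 * (2 ^ d - 1) + 1 + 1 = 2 * 2 ^ d := by
          have : 0 < 2 ^ d := by positivity
          omega
        rw [← h3, mul_add, mul_one] at h2
        omega
      rw [h1, padicValNat.mul (by positivity) (by omega), padicValNat.prime_pow,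
        padicValNat.eq_zero_of_not_dvd (by omega), add_zero]
    have hY1 : 2 ^ (e - 1) * 1 + p ≤ 2 ^ (e - 1) * (2 * T + δ) + p := by
      rw [hYs]
      omega
    have h1 := padicValNat_choose_split_le (u := e - 1) (by omega) le_rfl hY1
    rw [hYs, mul_one, ← hkp, Nat.choose_self, Nat.choose_one_right, padicValNat_one_right, hδ1,
      padicValNat.eq_zero_of_not_dvd (by omega : ¬ 2 ∣ 2 * T + 1)] at h1
    omega
  · have hu : padicValNat 2 j = e - 1 := by rw [hjl, padicValNat.prime_pow]
    have hlt : 2 ^ l < 2 ^ (e - 1) := Nat.pow_lt_pow_right (by norm_num) (by omega)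
    have hY1 : 2 ^ (e - 1) * 0 + k ≤ 2 ^ (e - 1) * (2 * T + δ) + p := by
      rw [hYs]
      omega
    obtain ⟨-, h1⟩ := padicValNat_choose_split_lt (u := e - 1) (by omega) (by omega) hY1
    have h2 := binOnes_two_pow_sub_add (e := e - 1) (w := l) (by omega) l3 hkp
    have h3 : 2 ^ (e - 1) + p - k = 2 ^ l := by omega
    rw [hYs, mul_zero, zero_add, Nat.choose_zero_right, padicValNat_one_right, Nat.sub_zero, hδ1,
      padicValNat.eq_zero_of_not_dvd (by omega : ¬ 2 ∣ 2 * T + 1), h3, binOnes_two_pow, h2] at h1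
    omega

end ZeroData

/-! ### Binomial sums over odd indices. -/

/-- Pascal's rule twice, passing through the even-index sums. The bound B is free so that one range
serves n, n+1 and n+2. -/
theorem sum_choose_odd_mul_choose_succ_succ {B n : ℕ} (hn : n + 1 < 2 * B) (m : ℕ) :
    ∑ i ∈ Finset.range B, (n + 2).choose (2 * i + 1) * i.choose m =
      2 * (∑ i ∈ Finset.range B, (n + 1).choose (2 * i + 1) * i.choose m) +
        ∑ i ∈ Finset.range B, n.choose (2 * i + 1) * ((i + 1).choose m - i.choose m) := by
  have hg (n : ℕ) (hn : n < 2 * B) :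
      ∑ i ∈ Finset.range B, (n + 1).choose (2 * i + 1) * i.choose m =
        (∑ i ∈ Finset.range B, n.choose (2 * i + 1) * i.choose m) +
          ∑ i ∈ Finset.range (B + 1), n.choose (2 * i) * i.choose m := by
    rw [Finset.sum_range_succ _ B, Nat.choose_eq_zero_of_lt hn, zero_mul, add_zero,
      ← Finset.sum_add_distrib]
    refine Finset.sum_congr rfl fun i _ => ?_
    rw [Nat.choose_succ_succ]
    ring
  have hh : ∑ i ∈ Finset.range (B + 1), (n + 1).choose (2 * i) * i.choose m =
      (∑ i ∈ Finset.range B, n.choose (2 * i + 1) * (i + 1).choose m) +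
        ∑ i ∈ Finset.range (B + 1), n.choose (2 * i) * i.choose m := by
    rw [Finset.sum_range_succ', Finset.sum_range_succ' (n := B), ← add_assoc,
      ← Finset.sum_add_distrib, mul_zero, Nat.choose_zero_right, Nat.choose_zero_right]
    congr 1
    refine Finset.sum_congr rfl fun i _ => ?_
    rw [show 2 * (i + 1) = 2 * i + 1 + 1 by ring, Nat.choose_succ_succ]
    ring
  have hd : ∑ i ∈ Finset.range B, n.choose (2 * i + 1) * (i + 1).choose m =
      (∑ i ∈ Finset.range B, n.choose (2 * i + 1) * i.choose m) +
        ∑ i ∈ Finset.range B, n.choose (2 * i + 1) * ((i + 1).choose m - i.choose m) := by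
    rw [← Finset.sum_add_distrib]
    refine Finset.sum_congr rfl fun i _ => ?_
    rw [← mul_add, Nat.add_sub_cancel' (Nat.choose_le_choose m (Nat.le_succ i))]
  have h1 := hg (n + 1) hn
  have h2 := hg n (by omega)
  rw [h1, hh, hd]
  omega

/-- Both sides satisfy a_{n+2}(m) = 2a_{n+1}(m)+a_n(m-1). -/
theorem sum_choose_odd_mul_choose {B n : ℕ} (hn : n ≤ 2 * B) (m : ℕ) :
    ∑ i ∈ Finset.range B, n.choose (2 * i + 1) * i.choose m =
      if 2 * m < n then 2 ^ (n - 1 - 2 * m) * (n - 1 - m).choose m else 0 := by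
  induction n using Nat.strong_induction_on generalizing m with
  | _ n ih =>
    match n with
    | 0 => simp
    | 1 =>
      obtain ⟨b, rfl⟩ := Nat.exists_eq_succ_of_ne_zero (by omega : B ≠ 0)
      rw [Finset.sum_range_succ', Finset.sum_eq_zero]
      · rcases Nat.eq_zero_or_pos m with rfl | hm
        · simp
        · rw [Nat.choose_eq_zero_of_lt hm, if_neg (by omega)]
          simp
      · intro i _
        rw [Nat.choose_eq_zero_of_lt (by omega), zero_mul]
    | n + 2 =>
      rw [sum_choose_odd_mul_choose_succ_succ (by omega), ih (n + 1) (by omega) (by omega)]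
      rcases m with _ | m
      · simp only [Nat.choose_zero_right, Nat.sub_self, mul_zero, Finset.sum_const_zero, add_zero,
          mul_one, Nat.sub_zero]
        rw [if_pos (Nat.succ_pos n), if_pos (Nat.succ_pos (n + 1)),
          show n + 2 - 1 = n + 1 - 1 + 1 by omega]
        ring
      · have h1 : ∑ i ∈ Finset.range B, n.choose (2 * i + 1) *
            ((i + 1).choose (m + 1) - i.choose (m + 1)) =
              ∑ i ∈ Finset.range B, n.choose (2 * i + 1) * i.choose m := by
          refine Finset.sum_congr rfl fun i _ => ?_
          rw [Nat.choose_succ_succ, Nat.add_sub_cancel]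
        rw [h1, ih n (by omega) (by omega)]
        rcases Nat.lt_or_ge (2 * m) n with h2 | h2
        · rw [if_pos (show 2 * (m + 1) < n + 2 by omega), if_pos h2]
          obtain ⟨d, rfl⟩ := Nat.exists_eq_add_of_lt h2
          rw [show 2 * m + d + 1 + 2 - 1 - (m + 1) = m + d + 1 by omega,
            Nat.choose_succ_succ, show 2 * m + d + 1 + 2 - 1 - 2 * (m + 1) = d by omega,
            show 2 * m + d + 1 - 1 - 2 * m = d by omega,
            show 2 * m + d + 1 - 1 - m = m + d by omega,
            show 2 * m + d + 1 + 1 - 1 - (m + 1) = m + d by omega]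
          rcases d with _ | d
          · rw [if_neg (show ¬ 2 * (m + 1) < 2 * m + 0 + 1 + 1 by omega), add_zero,
              Nat.choose_eq_zero_of_lt (Nat.lt_succ_self m)]
            ring
          · rw [if_pos (show 2 * (m + 1) < 2 * m + (d + 1) + 1 + 1 by omega),
              show 2 * m + (d + 1) + 1 + 1 - 1 - 2 * (m + 1) = d by omega]
            ring
        · rw [if_neg (by omega), if_neg (by omega), if_neg (by omega)]

/-! ### Divisibility of differences of powers. -/

/-- The m-th difference at 0 reads off the coefficient of C(x,m). -/
theorem dvd_fwdDiff_of_mem_closure {w : ℕ → ℤ} {f : ℕ → ℤ}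
    (hf : f ∈ AddSubgroup.closure (Set.range fun k (x : ℕ) => w k * (x.choose k : ℤ))) (m : ℕ) :
    w m ∣ (fwdDiff 1)^[m] f 0 := by
  induction hf using AddSubgroup.closure_induction with
  | mem f hf =>
    obtain ⟨k, rfl⟩ := hf
    have h : (fun x : ℕ => w k * (x.choose k : ℤ)) = w k • fun x : ℕ => (x.choose k : ℤ) := rfl
    change w m ∣ (fwdDiff 1)^[m] (fun x : ℕ => w k * (x.choose k : ℤ)) 0
    rw [h, fwdDiff_iter_const_smul, Pi.smul_apply, fwdDiff_iter_choose_zero]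
    split_ifs with hk
    · rw [hk]
      simp
    · simp
  | zero =>
    simp [fwdDiff_iter_eq_sum_shift]
  | add f g _ _ hf hg =>
    rw [fwdDiff_iter_add]
    exact dvd_add hf hg
  | neg f _ hf =>
    have h : -f = (-1 : ℤ) • f := by simp
    rw [h, fwdDiff_iter_const_smul, Pi.smul_apply]
    exact Dvd.dvd.mul_left hf _

/-- The function `2 ^ k * C(x, k)`. -/
def twoPowChoose (k : ℕ) : ℕ → ℤ := fun x => 2 ^ k * (x.choose k : ℤ)

/-- The integral span of the functions `2 ^ k * C(x, k)` with `i ≤ k`. -/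
def twoPowChooseSpan (i : ℕ) : AddSubgroup (ℕ → ℤ) :=
  AddSubgroup.closure (twoPowChoose '' Set.Ici i)

theorem twoPowChoose_mem {i k : ℕ} (h : i ≤ k) : twoPowChoose k ∈ twoPowChooseSpan i :=
  AddSubgroup.subset_closure ⟨k, h, rfl⟩

/-- Vandermonde for y = a+(y-a), then C(y,a) C(y-a,i) = C(y,a+i) C(a+i,a). The drop in degree leaves
the spare power of 2. -/
theorem twoPowChoose_mul (a c : ℕ) :
    twoPowChoose a * twoPowChoose c =
      ∑ x ∈ Finset.HasAntidiagonal.antidiagonal c,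
        ((2 ^ x.1 * (a.choose x.1 * (a + x.2).choose a) : ℕ) : ℤ) • twoPowChoose (a + x.2) := by
  funext y
  simp only [Pi.mul_apply, Finset.sum_apply, Pi.smul_apply, smul_eq_mul, twoPowChoose]
  rcases Nat.lt_or_ge y a with hya | hya
  · rw [Nat.choose_eq_zero_of_lt hya, Finset.sum_eq_zero]
    · simp
    · intro x _
      rw [Nat.choose_eq_zero_of_lt (by omega : y < a + x.2)]
      simp
  · have h1 : (y.choose c : ℤ) =
        ∑ x ∈ Finset.HasAntidiagonal.antidiagonal c, (a.choose x.1 : ℤ) * ((y - a).choose x.2 : ℤ) := by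
      conv_lhs => rw [← Nat.add_sub_cancel' hya, Nat.add_choose_eq]
      push_cast
      rfl
    rw [h1, Finset.mul_sum, Finset.mul_sum]
    refine Finset.sum_congr rfl fun x hx => ?_
    have h2 : y.choose (a + x.2) * (a + x.2).choose a = y.choose a * (y - a).choose x.2 := by
      rw [Nat.choose_mul (Nat.le_add_right a x.2), Nat.add_sub_cancel_left]
    have h3 : ((y.choose (a + x.2) : ℤ) * ((a + x.2).choose a : ℤ)) =
        (y.choose a : ℤ) * ((y - a).choose x.2 : ℤ) := by exact_mod_cast h2
    rw [← Finset.HasAntidiagonal.mem_antidiagonal.1 hx]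
    push_cast
    calc _ = 2 ^ a * 2 ^ (x.1 + x.2) * (a.choose x.1 : ℤ) *
          ((y.choose a : ℤ) * ((y - a).choose x.2 : ℤ)) := by ring
      _ = _ := by rw [← h3]; ring

theorem mul_mem_twoPowChooseSpan {i : ℕ} {f g : ℕ → ℤ} (hf : f ∈ twoPowChooseSpan i)
    (hg : g ∈ twoPowChooseSpan i) : f * g ∈ twoPowChooseSpan i := by
  induction hf using AddSubgroup.closure_induction with
  | mem f hf =>
    induction hg using AddSubgroup.closure_induction with
    | mem g hg =>
      obtain ⟨a, ha, rfl⟩ := hf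
      obtain ⟨c, hc, rfl⟩ := hg
      rw [twoPowChoose_mul]
      refine AddSubgroup.sum_mem _ fun x _ => AddSubgroup.zsmul_mem _ (twoPowChoose_mem ?_) _
      exact le_add_right ha
    | zero => rw [mul_zero]; exact AddSubgroup.zero_mem _
    | add g g' _ _ hg hg' => rw [mul_add]; exact AddSubgroup.add_mem _ hg hg'
    | neg g _ hg => rw [mul_neg]; exact AddSubgroup.neg_mem _ hg
  | zero => rw [zero_mul]; exact AddSubgroup.zero_mem _
  | add f f' _ _ hf hf' => rw [add_mul]; exact AddSubgroup.add_mem _ hf hf'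
  | neg f _ hf => rw [neg_mul]; exact AddSubgroup.neg_mem _ hf

/-- Squaring gains a factor 2: cross terms are doubled, and in the square of a generator each
coefficient carries either a power of 2 or the central binomial coefficient C(2a,a), even for a ≥ 1.
-/
theorem mul_self_mem_twoPowChooseSpan {f : ℕ → ℤ} (hf : f ∈ twoPowChooseSpan 1) :
    ∃ g ∈ twoPowChooseSpan 1, f * f = (2 : ℤ) • g := by
  induction hf using AddSubgroup.closure_induction with
  | mem f hf =>
    obtain ⟨a, ha, rfl⟩ := hf
    rw [Set.mem_Ici] at ha
    have h (x : ℕ × ℕ) (hx : x ∈ Finset.HasAntidiagonal.antidiagonal a) :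
        ∃ z : ℕ, 2 ^ x.1 * (a.choose x.1 * (a + x.2).choose a) = 2 * z := by
      change 2 ∣ _
      rw [Finset.HasAntidiagonal.mem_antidiagonal] at hx
      rcases Nat.eq_zero_or_pos x.1 with h0 | h0
      · have h1 : x.2 = a := by omega
        rw [h1, ← two_mul]
        exact ((Nat.two_dvd_centralBinom_of_one_le ha).mul_left _).mul_left _
      · exact (dvd_pow_self 2 h0.ne').mul_right _
    choose! z hz using h
    refine ⟨∑ x ∈ Finset.HasAntidiagonal.antidiagonal a, (z x : ℤ) • twoPowChoose (a + x.2),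
      AddSubgroup.sum_mem _ fun x _ => AddSubgroup.zsmul_mem _ (twoPowChoose_mem (by omega)) _, ?_⟩
    rw [twoPowChoose_mul, Finset.smul_sum]
    refine Finset.sum_congr rfl fun x hx => ?_
    rw [hz x hx, smul_smul]
    push_cast
    rfl
  | zero => exact ⟨0, AddSubgroup.zero_mem _, by simp⟩
  | add f f' hf hf' h h' =>
    obtain ⟨g, hg, h1⟩ := h
    obtain ⟨g', hg', h1'⟩ := h'
    refine ⟨g + f * f' + g', AddSubgroup.add_mem _ (AddSubgroup.add_mem _ hg
      (mul_mem_twoPowChooseSpan hf hf')) hg', ?_⟩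
    have : (f + f') * (f + f') = f * f + (2 : ℤ) • (f * f') + f' * f' := by
      rw [zsmul_eq_mul]
      push_cast
      ring
    rw [this, h1, h1', smul_add, smul_add]
  | neg f _ h =>
    obtain ⟨g, hg, h1⟩ := h
    exact ⟨g, hg, by rw [neg_mul_neg, h1]⟩

/-- Repeated squaring: (2x^(2^h))² is 4x^(2^(h+1)), and one factor 2 is won back. -/
theorem two_mul_pow_two_pow_mem (h : ℕ) :
    (2 : ℤ) • (fun x : ℕ => (x : ℤ) ^ 2 ^ h) ∈ twoPowChooseSpan 1 := by
  induction h with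
  | zero =>
    convert twoPowChoose_mem (le_refl 1) using 1
    funext x
    simp [twoPowChoose]
  | succ h ih =>
    obtain ⟨g, hg, h1⟩ := mul_self_mem_twoPowChooseSpan ih
    convert hg using 1
    funext x
    have h2 := congrFun h1 x
    simp only [Pi.mul_apply, Pi.smul_apply, smul_eq_mul] at h2 ⊢
    rw [pow_succ, pow_mul]
    linarith

/-- Multiply the functions 2x^(2^h) over the binary digits of s. -/
theorem two_pow_binOnes_mul_pow_mem (s : ℕ) :
    (2 ^ binOnes s : ℤ) • (fun x : ℕ => (x : ℤ) ^ s) ∈ twoPowChooseSpan 0 := by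
  have key (a : ℕ) : ∀ s < 2 ^ a,
      (2 ^ binOnes s : ℤ) • (fun x : ℕ => (x : ℤ) ^ s) ∈ twoPowChooseSpan 0 := by
    induction a with
    | zero =>
      intro s hs
      obtain rfl : s = 0 := by simpa using hs
      convert twoPowChoose_mem (le_refl 0) using 1
      funext x
      simp [twoPowChoose, binOnes_zero]
    | succ a ih =>
      intro s hs
      rcases Nat.lt_or_ge s (2 ^ a) with hsa | hsa
      · exact ih s hsa
      · obtain ⟨t, rfl⟩ := Nat.exists_eq_add_of_le hsa
        have ht : t < 2 ^ a := by rw [pow_succ] at hs; omega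
        have h1 : twoPowChooseSpan 1 ≤ twoPowChooseSpan 0 :=
          AddSubgroup.closure_mono (Set.image_mono (Set.Ici_subset_Ici.2 (Nat.zero_le _)))
        have h2 := mul_mem_twoPowChooseSpan (h1 (two_mul_pow_two_pow_mem a)) (ih t ht)
        convert h2 using 1
        funext x
        simp only [Pi.mul_apply, Pi.smul_apply, smul_eq_mul, binOnes_two_pow_add ht]
        ring
  exact key s s Nat.lt_two_pow_self

/-- The `m`-th difference at `0` of the `s`-th power function. -/
def powDiff (s m : ℕ) : ℤ := (fwdDiff 1)^[m] (fun x : ℕ => (x : ℤ) ^ s) 0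

theorem powDiff_eq (s m : ℕ) : powDiff s m = (fwdDiff 1)^[m] (fun x : ℤ => x ^ s) 0 := by
  unfold powDiff
  rw [fwdDiff_iter_eq_sum_shift, fwdDiff_iter_eq_sum_shift]
  simp

theorem powDiff_self (s : ℕ) : powDiff s s = s.factorial := by
  rw [powDiff_eq, fwdDiff_iter_eq_factorial]
  simp

theorem powDiff_eq_zero {s m : ℕ} (h : s < m) : powDiff s m = 0 := by
  rw [powDiff_eq, fwdDiff_iter_pow_eq_zero_of_lt h]
  rfl

theorem two_pow_dvd_powDiff (s m : ℕ) : (2 ^ m : ℤ) ∣ 2 ^ binOnes s * powDiff s m := by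
  have h := two_pow_binOnes_mul_pow_mem s
  have h1 : twoPowChoose '' Set.Ici 0 =
      Set.range fun k (x : ℕ) => (2 ^ k : ℤ) * (x.choose k : ℤ) := by
    ext f
    simp only [Set.mem_image, Set.mem_range, Set.mem_Ici, Nat.zero_le, true_and]
    rfl
  unfold twoPowChooseSpan at h
  rw [h1] at h
  have h2 := dvd_fwdDiff_of_mem_closure h m
  rwa [fwdDiff_iter_const_smul] at h2

/-- Falling factorials satisfy x (x)_k = (x)_{k+1}+k (x)_k, so powers stay in their integral span.
-/
theorem factorial_dvd_powDiff (s m : ℕ) : (m.factorial : ℤ) ∣ powDiff s m := by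
  refine dvd_fwdDiff_of_mem_closure (w := fun k => (k.factorial : ℤ)) ?_ m
  induction s with
  | zero =>
    refine AddSubgroup.subset_closure ⟨0, ?_⟩
    funext x
    simp
  | succ s ih =>
    have h : (fun x : ℕ => (x : ℤ) ^ (s + 1)) = (fun x : ℕ => (x : ℤ)) * fun x : ℕ => (x : ℤ) ^ s := by
      funext x
      simp [pow_succ']
    rw [h]
    generalize (fun x : ℕ => (x : ℤ) ^ s) = f at ih
    induction ih using AddSubgroup.closure_induction with
    | mem f hf =>
      obtain ⟨k, rfl⟩ := hf
      have h1 : ((fun x : ℕ => (x : ℤ)) * fun x : ℕ => (k.factorial : ℤ) * (x.choose k : ℤ)) =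
          (fun x : ℕ => ((k + 1).factorial : ℤ) * (x.choose (k + 1) : ℤ)) +
            k • fun x : ℕ => (k.factorial : ℤ) * (x.choose k : ℤ) := by
        funext x
        have h2 : ((x.choose (k + 1) : ℤ) * (k + 1)) = (x.choose k : ℤ) * (x - k) := by
          rcases Nat.lt_or_ge x k with hx | hx
          · rw [Nat.choose_eq_zero_of_lt hx, Nat.choose_eq_zero_of_lt (by omega)]
            simp
          · have := Nat.choose_succ_right_eq x k
            zify [hx] at this
            exact this
        simp only [Pi.mul_apply, Pi.add_apply, nsmul_eq_mul, Nat.factorial_succ]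
        push_cast
        linear_combination (-(k.factorial : ℤ)) * h2
      rw [h1]
      exact AddSubgroup.add_mem _ (AddSubgroup.subset_closure ⟨k + 1, rfl⟩)
        (nsmul_mem (AddSubgroup.subset_closure (Set.mem_range_self k)) k)
    | zero => rw [mul_zero]; exact AddSubgroup.zero_mem _
    | add f f' _ _ hf hf' => rw [mul_add]; exact AddSubgroup.add_mem _ hf hf'
    | neg f _ hf => rw [mul_neg]; exact AddSubgroup.neg_mem _ hf

theorem pow_eq_sum_powDiff (i s : ℕ) :
    (i : ℤ) ^ s = ∑ m ∈ Finset.range (s + 1), (i.choose m : ℤ) * powDiff s m := by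
  have h := shift_eq_sum_fwdDiff_iter 1 (fun x : ℕ => (x : ℤ) ^ s) i 0
  simp only [smul_eq_mul, mul_one, zero_add, nsmul_eq_mul] at h
  rw [h]
  have h1 : ∑ m ∈ Finset.range (i + 1), (i.choose m : ℤ) * powDiff s m =
      ∑ m ∈ Finset.range (i + s + 1), (i.choose m : ℤ) * powDiff s m := by
    refine Finset.sum_subset (Finset.range_mono (by omega)) fun m _ hm => ?_
    rw [Finset.mem_range] at hm
    rw [Nat.choose_eq_zero_of_lt (by omega)]
    simp
  have h2 : ∑ m ∈ Finset.range (s + 1), (i.choose m : ℤ) * powDiff s m =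
      ∑ m ∈ Finset.range (i + s + 1), (i.choose m : ℤ) * powDiff s m := by
    refine Finset.sum_subset (Finset.range_mono (by omega)) fun m _ hm => ?_
    rw [Finset.mem_range] at hm
    rw [powDiff_eq_zero (by omega), mul_zero]
  rw [h2, ← h1]
  rfl

theorem factorial_mul_Phi (n s : ℕ) :
    (n.factorial : ℚ) * Phi n s = ∑ m ∈ (Finset.range (s + 1)).filter (fun m => 2 * m < n),
      (2 ^ s * powDiff s m * (2 ^ (n - 1 - 2 * m) * (n - 1 - m).choose m) : ℚ) := by
  have hn : (n.factorial : ℚ) ≠ 0 := by exact_mod_cast n.factorial_ne_zero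
  unfold Phi
  rw [← mul_assoc, mul_one_div_cancel hn, one_mul]
  have h1 (i : ℕ) : (2 * (i : ℚ)) ^ s =
      ∑ m ∈ Finset.range (s + 1), 2 ^ s * (powDiff s m : ℚ) * (i.choose m : ℚ) := by
    have h2 : (i : ℚ) ^ s = ∑ m ∈ Finset.range (s + 1), (i.choose m : ℚ) * (powDiff s m : ℚ) := by
      exact_mod_cast pow_eq_sum_powDiff i s
    rw [mul_pow, h2, Finset.mul_sum]
    refine Finset.sum_congr rfl fun m _ => ?_
    ring
  simp_rw [h1, Finset.mul_sum]
  rw [Finset.sum_comm, Finset.sum_filter]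
  refine Finset.sum_congr rfl fun m _ => ?_
  have h3 := sum_choose_odd_mul_choose (B := n) (n := n) (by omega) m
  have h4 : ∑ i ∈ Finset.range n, (n.choose (2 * i + 1) : ℚ) * (i.choose m : ℚ) =
      if 2 * m < n then (2 ^ (n - 1 - 2 * m) * (n - 1 - m).choose m : ℚ) else 0 := by
    rw [← Nat.cast_zero, ← Nat.cast_ofNat (R := ℚ), ← Nat.cast_pow, ← Nat.cast_mul, ← Nat.cast_ite,
      ← h3]
    push_cast
    rfl
  calc _ = 2 ^ s * (powDiff s m : ℚ) *
        ∑ i ∈ Finset.range n, (n.choose (2 * i + 1) : ℚ) * (i.choose m : ℚ) := by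
        rw [Finset.mul_sum]
        refine Finset.sum_congr rfl fun i _ => ?_
        ring
    _ = _ := by
        rw [h4]
        split_ifs <;> simp

/-! ### Leading 2-adic digits. -/

/-- `x` lies in `2 ^ t * ℤ_2`, and `c` is the residue of `x / 2 ^ t` modulo `2`. -/
def HasResidue (t : ℤ) (x : ℚ_[2]) (c : ZMod 2) : Prop :=
  ∃ z : ℤ_[2], x = 2 ^ t * (z : ℚ_[2]) ∧ PadicInt.toZMod z = c

theorem le_nu_iff {t : ℤ} {x : ℚ_[2]} : (t : WithTop ℤ) ≤ nu x ↔ ‖x‖ ≤ 2 ^ (-t) := by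
  unfold nu
  rcases eq_or_ne x 0 with rfl | hx
  · simp only [AddValuation.map_zero, le_top, norm_zero, true_iff]
    positivity
  · rw [Padic.addValuation.apply hx, WithTop.coe_le_coe, Padic.norm_eq_zpow_neg_valuation hx]
    push_cast
    rw [zpow_le_zpow_iff_right₀ (by norm_num)]
    omega

theorem nu_eq_iff {t : ℤ} {x : ℚ_[2]} : nu x = (t : WithTop ℤ) ↔ ‖x‖ = 2 ^ (-t) := by
  unfold nu
  rcases eq_or_ne x 0 with rfl | hx
  · simp only [AddValuation.map_zero, WithTop.top_ne_coe, norm_zero, false_iff]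
    have : (0 : ℝ) < 2 ^ (-t) := by positivity
    exact this.ne
  · rw [Padic.addValuation.apply hx, WithTop.coe_inj, Padic.norm_eq_zpow_neg_valuation hx]
    push_cast
    rw [zpow_right_inj₀ (by norm_num) (by norm_num)]
    omega

theorem norm_two_zpow (t : ℤ) : ‖(2 : ℚ_[2]) ^ t‖ = 2 ^ (-t) := by
  have := Padic.norm_p_zpow (p := 2) t
  exact_mod_cast this

theorem toZMod_eq_zero_iff (z : ℤ_[2]) : PadicInt.toZMod z = 0 ↔ ‖z‖ < 1 := by
  rw [← RingHom.mem_ker, PadicInt.ker_toZMod, IsLocalRing.mem_maximalIdeal,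
    PadicInt.mem_nonunits]

theorem toZMod_eq_one_iff (z : ℤ_[2]) : PadicInt.toZMod z = 1 ↔ ‖z‖ = 1 := by
  have h1 : ∀ c : ZMod 2, c = 1 ↔ c ≠ 0 := by decide
  rw [h1, Ne, toZMod_eq_zero_iff]
  have := PadicInt.norm_le_one z
  constructor
  · intro h
    exact le_antisymm this (not_lt.1 h)
  · intro h
    rw [h]
    exact lt_irrefl _

theorem exists_hasResidue_iff {t : ℤ} {x : ℚ_[2]} : (∃ c, HasResidue t x c) ↔ ‖x‖ ≤ 2 ^ (-t) := by
  have h2 : (0 : ℝ) < 2 ^ (-t) := by positivity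
  constructor
  · rintro ⟨c, z, rfl, -⟩
    rw [norm_mul, norm_two_zpow, ← PadicInt.norm_def]
    exact mul_le_of_le_one_right h2.le (PadicInt.norm_le_one z)
  · intro h
    have h1 : ‖x * 2 ^ (-t)‖ ≤ 1 := by
      rw [norm_mul, norm_two_zpow, neg_neg, ← le_div_iff₀ (by positivity), one_div, ← zpow_neg]
      exact h
    refine ⟨_, ⟨x * 2 ^ (-t), h1⟩, ?_, rfl⟩
    have h3 : (2 : ℚ_[2]) ^ t ≠ 0 := zpow_ne_zero _ two_ne_zero
    change x = 2 ^ t * (x * 2 ^ (-t))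
    rw [zpow_neg]
    field_simp

theorem hasResidue_one_iff {t : ℤ} {x : ℚ_[2]} : HasResidue t x 1 ↔ ‖x‖ = 2 ^ (-t) := by
  have h2 : (0 : ℝ) < 2 ^ (-t) := by positivity
  constructor
  · rintro ⟨z, rfl, hz⟩
    rw [toZMod_eq_one_iff] at hz
    rw [norm_mul, norm_two_zpow, ← PadicInt.norm_def, hz, mul_one]
  · intro h
    obtain ⟨c, z, rfl, hz⟩ := exists_hasResidue_iff.2 h.le
    refine ⟨z, rfl, ?_⟩
    rw [norm_mul, norm_two_zpow, ← PadicInt.norm_def] at h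
    rw [toZMod_eq_one_iff]
    exact (mul_eq_left₀ h2.ne').1 h

namespace HasResidue

theorem le_nu {t : ℤ} {x : ℚ_[2]} {c : ZMod 2} (h : HasResidue t x c) :
    (t : WithTop ℤ) ≤ nu x :=
  le_nu_iff.2 (exists_hasResidue_iff.1 ⟨c, h⟩)

theorem unique {t : ℤ} {x : ℚ_[2]} {c c' : ZMod 2} (h : HasResidue t x c)
    (h' : HasResidue t x c') : c = c' := by
  obtain ⟨z, rfl, rfl⟩ := h
  obtain ⟨z', hz, rfl⟩ := h'
  have h3 : (2 : ℚ_[2]) ^ t ≠ 0 := zpow_ne_zero _ two_ne_zero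
  rw [Subtype.ext (mul_left_cancel₀ h3 hz)]

theorem nu_eq_iff {t : ℤ} {x : ℚ_[2]} {c : ZMod 2} (h : HasResidue t x c) :
    nu x = (t : WithTop ℤ) ↔ c = 1 := by
  rw [_root_.nu_eq_iff, ← hasResidue_one_iff]
  exact ⟨fun h' => h.unique h', fun h' => h' ▸ h⟩

theorem add {t : ℤ} {x y : ℚ_[2]} {c c' : ZMod 2} (h : HasResidue t x c)
    (h' : HasResidue t y c') : HasResidue t (x + y) (c + c') := by
  obtain ⟨z, rfl, rfl⟩ := h
  obtain ⟨z', rfl, rfl⟩ := h'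
  exact ⟨z + z', by push_cast; ring, map_add _ _ _⟩

theorem sub {t : ℤ} {x y : ℚ_[2]} {c c' : ZMod 2} (h : HasResidue t x c)
    (h' : HasResidue t y c') : HasResidue t (x - y) (c - c') := by
  obtain ⟨z, rfl, rfl⟩ := h
  obtain ⟨z', rfl, rfl⟩ := h'
  exact ⟨z - z', by push_cast; ring, map_sub _ _ _⟩

theorem zero (t : ℤ) : HasResidue t 0 0 := ⟨0, by simp, map_zero _⟩

theorem sum {ι : Type*} {t : ℤ} {s : Finset ι} {f : ι → ℚ_[2]} {c : ι → ZMod 2}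
    (h : ∀ i ∈ s, HasResidue t (f i) (c i)) :
    HasResidue t (∑ i ∈ s, f i) (∑ i ∈ s, c i) := by
  classical
  induction s using Finset.induction_on with
  | empty => exact zero t
  | insert a s ha ih =>
    rw [Finset.sum_insert ha, Finset.sum_insert ha]
    exact (h a (Finset.mem_insert_self a s)).add
      (ih fun i hi => h i (Finset.mem_insert_of_mem hi))

theorem mul {t t' : ℤ} {x y : ℚ_[2]} {c c' : ZMod 2} (h : HasResidue t x c)
    (h' : HasResidue t' y c') : HasResidue (t + t') (x * y) (c * c') := by
  obtain ⟨z, rfl, rfl⟩ := h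
  obtain ⟨z', rfl, rfl⟩ := h'
  refine ⟨z * z', ?_, map_mul _ _ _⟩
  rw [zpow_add₀ two_ne_zero]
  push_cast
  ring

theorem of_lt {t t' : ℤ} {x : ℚ_[2]} {c : ZMod 2} (h : HasResidue t x c) (ht : t' < t) :
    HasResidue t' x 0 := by
  obtain ⟨z, rfl, rfl⟩ := h
  obtain ⟨d, hd⟩ := Int.eq_ofNat_of_zero_le (sub_nonneg.2 (Int.add_one_le_iff.2 ht))
  refine ⟨2 * (2 ^ d * z), ?_, ?_⟩
  · rw [show t = t' + 1 + d by omega, zpow_add₀ two_ne_zero, zpow_add₀ two_ne_zero, zpow_one,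
      zpow_natCast]
    push_cast
    rw [show ((2 : ℤ_[2]) : ℚ_[2]) = 2 from rfl]
    ring
  · rw [map_mul]
    have : PadicInt.toZMod (2 : ℤ_[2]) = 0 := by
      rw [map_ofNat]
      rfl
    rw [this, zero_mul]

theorem natCast {a : ℕ} (ha : a ≠ 0) : HasResidue (padicValNat 2 a) (a : ℚ_[2]) 1 := by
  rw [hasResidue_one_iff, Padic.norm_eq_zpow_neg_valuation (by exact_mod_cast ha),
    Padic.valuation_natCast]
  push_cast
  rfl

theorem two_pow (a : ℕ) : HasResidue a ((2 : ℚ_[2]) ^ a) 1 := by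
  have h := natCast (a := 2 ^ a) (by positivity)
  rw [padicValNat.prime_pow] at h
  exact_mod_cast h

theorem inv {t : ℤ} {x : ℚ_[2]} (h : HasResidue t x 1) : HasResidue (-t) x⁻¹ 1 := by
  rw [hasResidue_one_iff] at h ⊢
  rw [norm_inv, h, ← zpow_neg]

theorem intCast {a : ℕ} {z : ℤ} (h : (2 : ℤ) ^ a ∣ z) : ∃ c, HasResidue a (z : ℚ_[2]) c := by
  obtain ⟨y, rfl⟩ := h
  refine ⟨_, (y : ℤ_[2]), ?_, rfl⟩
  rw [zpow_natCast]
  push_cast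
  rfl

end HasResidue

/-! ### Valuations of the terms of Φ_n. -/

/-- The contribution of the `m`-th difference of the power function to `Φ_n(s)`. -/
def phiTerm (n s m : ℕ) : ℚ :=
  2 ^ s * powDiff s m * (2 ^ (n - 1 - 2 * m) * (n - 1 - m).choose m) * (n.factorial : ℚ)⁻¹

theorem Phi_eq_sum_phiTerm (n s : ℕ) :
    Phi n s = ∑ m ∈ (Finset.range (s + 1)).filter (fun m => 2 * m < n), phiTerm n s m := by
  have hn : (n.factorial : ℚ) ≠ 0 := by exact_mod_cast n.factorial_ne_zero
  unfold phiTerm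
  rw [← Finset.sum_mul, ← factorial_mul_Phi]
  field_simp

theorem hasResidue_phiTerm_of {n s m a : ℕ} {c : ZMod 2} (hm : 2 * m < n)
    (h : HasResidue ((m : ℤ) - a) ((powDiff s m : ℤ) : ℚ_[2]) c) :
    HasResidue ((s : ℤ) - m + binOnes n - 1 - a + padicValNat 2 ((n - 1 - m).choose m))
      ((phiTerm n s m : ℚ) : ℚ_[2]) c := by
  have h1 := HasResidue.natCast n.factorial_ne_zero
  have h2 := HasResidue.natCast (a := (n - 1 - m).choose m) (Nat.choose_pos (by omega)).ne'
  have h3 := (((HasResidue.two_pow s).mul h).mul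
    ((HasResidue.two_pow (n - 1 - 2 * m)).mul h2)).mul h1.inv
  have h4 := padicValNat_factorial_add_binOnes n
  have h5 : ((phiTerm n s m : ℚ) : ℚ_[2]) = 2 ^ s * ((powDiff s m : ℤ) : ℚ_[2]) *
      (2 ^ (n - 1 - 2 * m) * ((n - 1 - m).choose m : ℚ_[2])) * (n.factorial : ℚ_[2])⁻¹ := by
    unfold phiTerm
    push_cast
    rfl
  simp only [one_mul, mul_one] at h3
  rw [h5]
  convert h3 using 1
  omega

theorem hasResidue_phiTerm_self {n s : ℕ} (hs : 2 * s < n) :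
    HasResidue ((binOnes n : ℤ) - 1 - binOnes s + padicValNat 2 ((n - 1 - s).choose s))
      ((phiTerm n s s : ℚ) : ℚ_[2]) 1 := by
  have h1 := HasResidue.natCast s.factorial_ne_zero
  have h4 := padicValNat_factorial_add_binOnes s
  have h5 : (padicValNat 2 s.factorial : ℤ) = (s : ℤ) - binOnes s := by omega
  rw [h5] at h1
  have h2 := hasResidue_phiTerm_of (s := s) (c := 1) hs (a := binOnes s) (by
    rw [powDiff_self]
    exact_mod_cast h1)
  convert h2 using 1
  ring

theorem exists_hasResidue_phiTerm {n s m : ℕ} (hm : 2 * m < n) :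
    ∃ c, HasResidue ((s : ℤ) - m + binOnes n - 1 - (min (binOnes m) (binOnes s) : ℕ) +
      padicValNat 2 ((n - 1 - m).choose m)) ((phiTerm n s m : ℚ) : ℚ_[2]) c := by
  suffices h : ∃ c, HasResidue ((m : ℤ) - (min (binOnes m) (binOnes s) : ℕ))
      ((powDiff s m : ℤ) : ℚ_[2]) c by
    obtain ⟨c, hc⟩ := h
    exact ⟨c, hasResidue_phiTerm_of hm hc⟩
  have hle := binOnes_le m
  rcases le_total (binOnes m) (binOnes s) with h | h
  · rw [min_eq_left h]
    have h1 := padicValNat_factorial_add_binOnes m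
    have h2 : (2 : ℤ) ^ padicValNat 2 m.factorial ∣ powDiff s m :=
      Dvd.dvd.trans (by exact_mod_cast pow_padicValNat_dvd) (factorial_dvd_powDiff s m)
    obtain ⟨c, hc⟩ := HasResidue.intCast h2
    refine ⟨c, ?_⟩
    convert hc using 1
    omega
  · rw [min_eq_right h]
    have h2 := two_pow_dvd_powDiff s m
    have h3 : m = binOnes s + (m - binOnes s) := by omega
    rw [h3, pow_add, ← h3] at h2
    obtain ⟨c, hc⟩ := HasResidue.intCast (Int.dvd_of_mul_dvd_mul_left (by positivity) h2)
    refine ⟨c, ?_⟩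
    convert hc using 1
    omega

/-- Absorption: j C(2^E,j) = 2^E C(2^E-1,j-1), and the last coefficient is odd. -/
theorem padicValNat_choose_two_pow {E j : ℕ} (hj : 0 < j) (hjE : j ≤ 2 ^ E) :
    padicValNat 2 ((2 ^ E).choose j) + padicValNat 2 j = E := by
  have hp : 0 < 2 ^ E := by positivity
  have h1 := Nat.add_one_mul_choose_eq (2 ^ E - 1) (j - 1)
  rw [Nat.sub_add_cancel hp, Nat.sub_add_cancel hj] at h1
  have h2 := congrArg (padicValNat 2) h1
  rw [padicValNat.mul hp.ne' (Nat.choose_pos (by omega)).ne', padicValNat.prime_pow,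
    padicValNat.mul (Nat.choose_pos hjE).ne' hj.ne'] at h2
  have h3 := binOnes_choose (n := 2 ^ E - 1) (k := j - 1) (by omega)
  have h4 := binOnes_compl (a := E) (z := j - 1) (by omega)
  have h5 := binOnes_compl (a := E) (z := 0) hp
  rw [binOnes_zero, Nat.sub_zero] at h5
  omega

namespace ZeroData

variable {e n r p q : ℕ}

theorem minimalPair_le (h : ZeroData e n r p q) {δ j k : ℕ}
    (hmp : MinimalPair e (Nat.log 2 (r + p)) p δ j k) :
    j ≤ 2 ^ e ∧ k ≤ q + δ * 2 ^ (e - 1) := by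
  have h1 := h.two_pow_e
  have h2 : p ≤ q := by
    rcases h.q_eq with h3 | ⟨w, -, h3⟩
    · exact h3.ge
    · exact h3 ▸ Nat.le_add_right _ _
  have h4 : 0 < 2 ^ Nat.log 2 (r + p) := by positivity
  rcases hmp with h3 | ⟨rfl, h3⟩ <;> omega

/-- The parameter d only adds d to the valuation of C(2^(e+d),j), so one weight inequality serves
every d. Only the summand m = j+k can have odd residue. -/
theorem hasResidue_term (h : ZeroData e n r p q) {δ j k Y : ℕ} (d : ℕ) (hδ : δ ≤ 1) (hj : 0 < j)
    (hY : Y % 2 ^ e = q + δ * 2 ^ (e - 1)) (c : ZMod 2)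
    (hc : c = 1 ↔ MinimalPair e (Nat.log 2 (r + p)) p δ j k) :
    HasResidue ((binOnes n : ℤ) - 1 - binOnes p + d)
      ((Y.choose k : ℚ_[2]) * ((2 ^ (e + d)).choose j : ℚ_[2]) * ((Phi n (j + k) : ℚ) : ℚ_[2])) c := by
  have hc0 : ∀ c : ZMod 2, c ≠ 1 → c = 0 := by decide
  have hYle : q + δ * 2 ^ (e - 1) ≤ Y := hY ▸ Nat.mod_le _ _
  rcases Nat.lt_or_ge Y k with hk | hk
  · have h1 : c ≠ 1 := fun h1 => by
      have := (h.minimalPair_le (hc.1 h1)).2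
      omega
    rw [hc0 c h1, Nat.choose_eq_zero_of_lt hk]
    simpa using HasResidue.zero _
  rcases Nat.lt_or_ge (2 ^ (e + d)) j with hjE | hjE
  · have h1 : c ≠ 1 := fun h1 => by
      have := (h.minimalPair_le (hc.1 h1)).1
      have : 2 ^ e ≤ 2 ^ (e + d) := Nat.pow_le_pow_right (by norm_num) (by omega)
      omega
    rw [hc0 c h1, Nat.choose_eq_zero_of_lt hjE]
    simpa using HasResidue.zero _
  have he := h.two_le
  have hY' : Y % 2 ^ (e - 1) = q := by
    rw [← Nat.mod_mod_of_dvd Y (pow_dvd_pow 2 (by omega : e - 1 ≤ e)), hY,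
      Nat.add_mul_mod_self_right, Nat.mod_eq_of_lt h.q_lt]
  have h1 := HasResidue.natCast (Nat.choose_pos hk).ne'
  have h2 := HasResidue.natCast (Nat.choose_pos hjE).ne'
  have h3 := padicValNat_choose_two_pow hj hjE
  have h12 := h1.mul h2
  rw [one_mul] at h12
  have hterm : ∀ m ∈ (Finset.range (j + k + 1)).filter (fun m => 2 * m < n),
      HasResidue ((binOnes n : ℤ) - 1 - binOnes p + d)
        ((Y.choose k : ℚ_[2]) * ((2 ^ (e + d)).choose j : ℚ_[2]) *
          ((phiTerm n (j + k) m : ℚ) : ℚ_[2])) (if m = j + k then c else 0) := by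
    intro m hm
    rw [Finset.mem_filter, Finset.mem_range] at hm
    split_ifs with hmj
    · subst hmj
      have h4 := h12.mul (hasResidue_phiTerm_self hm.2)
      rw [one_mul] at h4
      have h5 := (h.weight_le hj hk hY' hm.2).1
      by_cases hmp : MinimalPair e (Nat.log 2 (r + p)) p δ j k
      · rw [hc.2 hmp]
        have h6 := (h.weight_eq_of_minimalPair hδ hj hk hY hmp).2
        convert h4 using 1
        omega
      · rw [hc0 c (mt hc.1 hmp)]
        have h6 := mt (h.minimalPair_of_weight_eq hδ hj hk hY hm.2) hmp
        exact h4.of_lt (by omega)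
    · have h5 := h.weight_lt_of_lt hj hk hY' (by omega) hm.2
      obtain ⟨c', h4⟩ := exists_hasResidue_phiTerm (s := j + k) hm.2
      exact (h12.mul h4).of_lt (by omega)
  have hsum := HasResidue.sum hterm
  rw [← Finset.mul_sum] at hsum
  have hval : ∑ m ∈ (Finset.range (j + k + 1)).filter (fun m => 2 * m < n),
      (if m = j + k then c else 0) = c := by
    by_cases hmp : MinimalPair e (Nat.log 2 (r + p)) p δ j k
    · rw [Finset.sum_ite_eq', if_pos]
      rw [Finset.mem_filter, Finset.mem_range]
      exact ⟨by omega, (h.weight_eq_of_minimalPair hδ hj hk hY hmp).1⟩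
    · rw [hc0 c (mt hc.1 hmp)]
      simp
  rw [hval] at hsum
  rw [Phi_eq_sum_phiTerm]
  push_cast
  exact hsum

end ZeroData

/-! ### Integer arguments, and increments of P_n. -/

theorem HasResidue.norm_le_of_zero {t : ℤ} {x : ℚ_[2]} (h : HasResidue t x 0) :
    ‖x‖ ≤ 2 ^ (-(t + 1)) := by
  obtain ⟨z, rfl, hz⟩ := h
  rw [toZMod_eq_zero_iff, PadicInt.norm_lt_one_iff_dvd] at hz
  obtain ⟨y, rfl⟩ := hz
  refine exists_hasResidue_iff.1 ⟨_, y, ?_, rfl⟩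
  rw [zpow_add₀ two_ne_zero, zpow_one, mul_assoc]
  push_cast
  rfl

theorem exists_hasResidue (x : ℚ_[2]) : ∃ t c, HasResidue t x c := by
  rcases eq_or_ne x 0 with rfl | hx
  · exact ⟨0, 0, HasResidue.zero 0⟩
  · refine ⟨x.valuation, 1, hasResidue_one_iff.2 ?_⟩
    rw [Padic.norm_eq_zpow_neg_valuation hx]
    push_cast
    rfl

/-- Generalized binomial coefficients are continuous: they agree with those of a natural number
modulo any given modulus. -/
theorem exists_nat_choose_congr (y : ℤ) (k : ℕ) (M : ℕ) (hM : 0 < M) :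
    ∃ Y : ℕ, (M : ℤ) ∣ Y - y ∧ (M : ℤ) ∣ (Y.choose k : ℤ) - Ring.choose y k := by
  have hk : (0 : ℤ) < k.factorial := by exact_mod_cast k.factorial_pos
  have hnn : 0 ≤ y + y.natAbs * (k.factorial * M : ℕ) := by
    have h1 : (1 : ℤ) ≤ (k.factorial * M : ℕ) := by
      exact_mod_cast Nat.mul_pos k.factorial_pos hM
    have h2 : (y.natAbs : ℤ) * 1 ≤ y.natAbs * (k.factorial * M : ℕ) :=
      mul_le_mul_of_nonneg_left h1 (by omega)
    omega
  obtain ⟨Y, hY⟩ := Int.eq_ofNat_of_zero_le hnn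
  have hd : (Y : ℤ) - y = k.factorial * M * y.natAbs := by
    have : (Y : ℤ) = y + y.natAbs * (k.factorial * M : ℕ) := hY.symm
    rw [this]
    push_cast
    ring
  refine ⟨Y, ⟨k.factorial * y.natAbs, by rw [hd]; ring⟩, ?_⟩
  have h1 := Polynomial.sub_dvd_eval_sub (Y : ℤ) y (descPochhammer ℤ k)
  rw [Polynomial.eval_eq_smeval, Polynomial.eval_eq_smeval,
    Ring.descPochhammer_eq_factorial_smul_choose, Ring.descPochhammer_eq_factorial_smul_choose,
    Ring.choose_natCast, ← smul_sub, nsmul_eq_mul, hd, mul_assoc] at h1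
  exact (Dvd.intro _ rfl).trans (Int.dvd_of_mul_dvd_mul_left hk.ne' h1)

theorem partialStirling_natCast (n y : ℕ) :
    partialStirling n (y : ℤ) = ∑ k ∈ Finset.range (y + 1), (y.choose k : ℚ) * Phi n k := by
  unfold partialStirling Phi
  simp_rw [Finset.mul_sum]
  rw [Finset.sum_comm]
  refine Finset.sum_congr rfl fun i _ => ?_
  rw [zpow_natCast, add_pow, Finset.mul_sum, Finset.mul_sum]
  refine Finset.sum_congr rfl fun k _ => ?_
  rw [one_pow]
  ring

/-- Expand (2i+1)^y ((2i+1)^M-1) in powers of 2i. The index `x.2` is j-1, the term j = 0 having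
cancelled. -/
theorem partialStirling_add_sub (n y M : ℕ) :
    partialStirling n ((y + M : ℕ) : ℤ) - partialStirling n (y : ℤ) =
      ∑ x ∈ Finset.range (y + 1) ×ˢ Finset.range M,
        (y.choose x.1 : ℚ) * (M.choose (x.2 + 1) : ℚ) * Phi n (x.2 + 1 + x.1) := by
  unfold partialStirling Phi
  rw [← mul_sub, ← Finset.sum_sub_distrib]
  simp_rw [Finset.mul_sum]
  rw [Finset.sum_comm]
  refine Finset.sum_congr rfl fun i _ => ?_
  have h1 : ((2 * (i : ℚ)) + 1) ^ M - 1 =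
      ∑ j ∈ Finset.range M, (2 * (i : ℚ)) ^ (j + 1) * (M.choose (j + 1) : ℚ) := by
    rw [add_pow, Finset.sum_range_succ']
    simp
  have h2 : ((2 * (i : ℚ)) + 1) ^ y =
      ∑ k ∈ Finset.range (y + 1), (2 * (i : ℚ)) ^ k * (y.choose k : ℚ) := by
    rw [add_pow]
    simp
  rw [zpow_natCast, zpow_natCast, pow_add, ← mul_sub, ← mul_sub_one, h1, h2, Finset.sum_mul_sum,
    ← Finset.sum_product', Finset.mul_sum, Finset.mul_sum]
  refine Finset.sum_congr rfl fun x _ => ?_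
  ring

namespace ZeroData

variable {e n r p q : ℕ}

theorem hasResidue_term_int (h : ZeroData e n r p q) {δ j k : ℕ} {y : ℤ} (hδ : δ ≤ 1)
    (hj : 0 < j) (hy : (2 ^ e : ℤ) ∣ y - (q + δ * 2 ^ (e - 1))) (c : ZMod 2)
    (hc : c = 1 ↔ MinimalPair e (Nat.log 2 (r + p)) p δ j k) :
    HasResidue ((binOnes n : ℤ) - 1 - binOnes p)
      (((Ring.choose y k : ℤ) : ℚ_[2]) * ((2 ^ e).choose j : ℚ_[2]) *
        ((Phi n (j + k) : ℚ) : ℚ_[2])) c := by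
  obtain ⟨u, c', hu⟩ := exists_hasResidue (((2 ^ e).choose j : ℚ_[2]) * ((Phi n (j + k) : ℚ) : ℚ_[2]))
  -- T is so large that changing C(y,k) by a multiple of 2^T does not affect the residue at the
  -- minimal level.
  obtain ⟨T, hT⟩ : ∃ T : ℕ, (binOnes n : ℤ) - 1 - binOnes p < T + u :=
    ⟨((binOnes n : ℤ) - 1 - binOnes p - u + 1).toNat, by omega⟩
  obtain ⟨Y, hY1, hY2⟩ := exists_nat_choose_congr y k (2 ^ T * 2 ^ e) (by positivity)
  have hYe : Y % 2 ^ e = q + δ * 2 ^ (e - 1) := by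
    have h1 : (2 ^ e : ℤ) ∣ Y - y := (Dvd.intro_left ((2 : ℤ) ^ T) (by push_cast; rfl)).trans hY1
    have h2 : ((2 ^ e : ℕ) : ℤ) ∣ (Y : ℤ) - ((q + δ * 2 ^ (e - 1) : ℕ) : ℤ) := by
      have := dvd_add h1 hy
      push_cast
      rwa [sub_add_sub_cancel] at this
    have h3 := (Nat.modEq_iff_dvd.2 h2).symm
    have h4 := h.q_lt
    have h5 := h.two_pow_e
    have h6 : δ * 2 ^ (e - 1) ≤ 1 * 2 ^ (e - 1) := Nat.mul_le_mul_right _ hδ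
    rwa [Nat.ModEq, Nat.mod_eq_of_lt (by omega : q + δ * 2 ^ (e - 1) < 2 ^ e)] at h3
  have h1 := h.hasResidue_term 0 hδ hj hYe c hc
  obtain ⟨c'', h2⟩ := HasResidue.intCast
    ((Dvd.intro ((2 : ℤ) ^ e) (by push_cast; rfl)).trans hY2 : (2 : ℤ) ^ T ∣ _)
  have h3 := (h2.mul hu).of_lt hT
  have h4 := h1.sub (by simpa using h3)
  rw [sub_zero] at h4
  convert h4 using 1
  · simp
  · rw [add_zero]
    ring

/-- The residue counts the minimal pairs modulo 2: one for δ = 0, three for δ = 1. -/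
theorem hasResidue_partialStirling_add_sub (h : ZeroData e n r p q) {δ Y : ℕ} (d : ℕ)
    (hδ : δ ≤ 1) (hY : Y % 2 ^ e = q + δ * 2 ^ (e - 1)) :
    HasResidue ((binOnes n : ℤ) - 1 - binOnes p + d)
      (((partialStirling n ((Y + 2 ^ (e + d) : ℕ) : ℤ) : ℚ) : ℚ_[2]) -
        ((partialStirling n (Y : ℤ) : ℚ) : ℚ_[2])) 1 := by
  classical
  have h1 : ∀ x ∈ Finset.range (Y + 1) ×ˢ Finset.range (2 ^ (e + d)),
      HasResidue ((binOnes n : ℤ) - 1 - binOnes p + d)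
        ((Y.choose x.1 : ℚ_[2]) * ((2 ^ (e + d)).choose (x.2 + 1) : ℚ_[2]) *
          ((Phi n (x.2 + 1 + x.1) : ℚ) : ℚ_[2]))
        (if MinimalPair e (Nat.log 2 (r + p)) p δ (x.2 + 1) x.1 then 1 else 0) := by
    intro x _
    refine h.hasResidue_term d hδ (Nat.succ_pos _) hY _ ?_
    split_ifs with h2
    · simp [h2]
    · simp [h2]
  have h2 := HasResidue.sum h1
  have h3 := congrArg (fun x : ℚ => (x : ℚ_[2])) (partialStirling_add_sub n Y (2 ^ (e + d)))
  push_cast at h3 h2 ⊢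
  rw [h3]
  convert h2 using 1
  rw [Finset.sum_boole]
  obtain ⟨l1, l2, l3, l4⟩ := h.log_spec
  have hmp := fun j k => h.minimalPair_le (δ := δ) (j := j) (k := k)
  generalize Nat.log 2 (r + p) = l at *
  have hpe := h.two_pow_e
  have hpl : 2 ^ l < 2 ^ (e - 1) := Nat.pow_lt_pow_right (by norm_num) (by omega)
  have hl0 : 0 < 2 ^ l := by positivity
  have hpd : 2 ^ e ≤ 2 ^ (e + d) := Nat.pow_le_pow_right (by norm_num) (by omega)
  have hYle : q + δ * 2 ^ (e - 1) ≤ Y := hY ▸ Nat.mod_le _ _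
  have hrange (x : ℕ × ℕ) (hx : MinimalPair e l p δ (x.2 + 1) x.1) :
      x ∈ Finset.range (Y + 1) ×ˢ Finset.range (2 ^ (e + d)) := by
    have := hmp _ _ hx
    rw [Finset.mem_product, Finset.mem_range, Finset.mem_range]
    omega
  have hfilter : (Finset.range (Y + 1) ×ˢ Finset.range (2 ^ (e + d))).filter
      (fun x => MinimalPair e l p δ (x.2 + 1) x.1) =
      if δ = 1 then {(p, 2 ^ e - 2 ^ l - 1), (2 ^ (e - 1) + p, 2 ^ (e - 1) - 2 ^ l - 1),
        (2 ^ (e - 1) + p - 2 ^ l, 2 ^ (e - 1) - 1)} else {(p, 2 ^ e - 2 ^ l - 1)} := by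
    ext ⟨k, j⟩
    rw [Finset.mem_filter, and_iff_right_of_imp (hrange _)]
    unfold MinimalPair
    split_ifs with h4
    · simp only [Finset.mem_insert, Finset.mem_singleton, Prod.mk.injEq]
      omega
    · simp only [Finset.mem_singleton, Prod.mk.injEq]
      omega
  rw [hfilter]
  split_ifs with h4
  · rw [Finset.card_eq_three.2 ⟨_, _, _, ?_, ?_, ?_, rfl⟩]
    · rfl
    · simp only [ne_eq, Prod.mk.injEq]
      omega
    · simp only [ne_eq, Prod.mk.injEq]
      omega
    · simp only [ne_eq, Prod.mk.injEq]
      omega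
  · simp

theorem exists_hasResidue_partialStirling_q (h : ZeroData e n r p q) :
    ∃ c, HasResidue ((binOnes n : ℤ) - 1 - binOnes p)
      ((partialStirling n (q : ℤ) : ℚ) : ℚ_[2]) c := by
  have hterm : ∀ k ∈ Finset.range (q + 1), ∃ c,
      HasResidue ((binOnes n : ℤ) - 1 - binOnes p)
        ((q.choose k : ℚ_[2]) * ((Phi n k : ℚ) : ℚ_[2])) c := by
    intro k hk
    have hkq : k ≤ q := Nat.lt_succ_iff.1 (Finset.mem_range.1 hk)
    have hterm' : ∀ m ∈ (Finset.range (k + 1)).filter (fun m => 2 * m < n), ∃ c,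
        HasResidue ((binOnes n : ℤ) - 1 - binOnes p)
          ((q.choose k : ℚ_[2]) * ((phiTerm n k m : ℚ) : ℚ_[2])) c := by
      intro m hm
      rw [Finset.mem_filter, Finset.mem_range] at hm
      obtain ⟨c, h1⟩ := exists_hasResidue_phiTerm (s := k) hm.2
      have h2 := (HasResidue.natCast (Nat.choose_pos hkq).ne').mul h1
      have h3 : min (binOnes m) (binOnes k) + m ≤ padicValNat 2 (q.choose k) + k + binOnes p +
          padicValNat 2 ((n - 1 - m).choose m) := by
        have h4 := min_le_right (binOnes m) (binOnes k)
        have h5 := binOnes_choose hkq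
        rcases h.q_eq with hq | ⟨w, hw, hq⟩
        · rw [hq] at h5 ⊢
          omega
        · have h6 := binOnes_add_le p (2 ^ w)
          rw [← hq, binOnes_two_pow] at h6
          by_cases h7 : m < k ∨ 1 ≤ padicValNat 2 ((n - 1 - m).choose m)
          · omega
          -- The only case where α(q) ≤ α(p)+1 is too weak; here 2^(w+1) ∣ k, so q may be replaced
          -- by p in the binomial coefficient.
          · have h8 : m = k := by omega
            have h9 : 2 ^ (w + 1) ∣ k := by
              by_contra hc
              rw [h8] at h7 hm
              exact h7 (Or.inr (one_le_padicValNat_choose (h.dvd_of_twist hw).1 hc hm.2))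
            obtain ⟨h10, h11⟩ := padicValNat_choose_sub_two_pow hkq (h.q_mod hw hq).1 h9
            have h12 := binOnes_choose h10
            rw [← h11, hq, Nat.add_sub_cancel] at h12
            rw [hq]
            omega
      rcases h3.lt_or_eq with h4 | h4
      · exact ⟨0, h2.of_lt (by omega)⟩
      · refine ⟨1 * c, ?_⟩
        convert h2 using 1
        omega
    choose! c hc using hterm'
    rw [Phi_eq_sum_phiTerm]
    push_cast
    rw [Finset.mul_sum]
    exact ⟨_, HasResidue.sum hc⟩
  choose! c hc using hterm
  refine ⟨∑ k ∈ Finset.range (q + 1), c k, ?_⟩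
  rw [partialStirling_natCast]
  push_cast
  exact HasResidue.sum hc

theorem exists_hasResidue_partialStirling (h : ZeroData e n r p q) {δ : ℕ} (hδ : δ ≤ 1) :
    ∃ c, HasResidue ((binOnes n : ℤ) - 1 - binOnes p)
      ((partialStirling n ((q + δ * 2 ^ (e - 1) : ℕ) : ℤ) : ℚ) : ℚ_[2]) c := by
  obtain ⟨c₀, h0⟩ := h.exists_hasResidue_partialStirling_q
  rcases Nat.eq_zero_or_pos δ with rfl | hδ1
  · exact ⟨c₀, by simpa using h0⟩
  obtain rfl : δ = 1 := by omega
  rw [one_mul]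
  have hpe := h.two_pow_e
  have hq := h.q_lt
  have hterm : ∀ x ∈ Finset.range (q + 1) ×ˢ Finset.range (2 ^ (e - 1)), ∃ c,
      HasResidue ((binOnes n : ℤ) - 1 - binOnes p)
        ((q.choose x.1 : ℚ_[2]) * ((2 ^ (e - 1)).choose (x.2 + 1) : ℚ_[2]) *
          ((Phi n (x.2 + 1 + x.1) : ℚ) : ℚ_[2])) c := by
    intro x hx
    rw [Finset.mem_product, Finset.mem_range, Finset.mem_range] at hx
    rw [exists_hasResidue_iff]
    have hl := h.log_spec.2.2.2
    -- Since 2^e-2^l > 2^(e-1) ≥ j, the pair is not minimal for δ = 0, so the term has a spare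
    -- factor 2; passing from C(2^e,j) to C(2^(e-1),j) spends it.
    have h1 := h.hasResidue_term (δ := 0) (j := x.2 + 1) (k := x.1) (Y := q) 0 (by omega)
      (Nat.succ_pos _) (by rw [zero_mul, add_zero, Nat.mod_eq_of_lt (by omega)]) 0 (by
        have hne : (0 : ZMod 2) ≠ 1 := by decide
        simp only [hne, false_iff]
        rintro (⟨h2, -⟩ | ⟨h2, -⟩)
        · have : 2 ^ Nat.log 2 (r + p) < 2 ^ (e - 1) :=
            Nat.pow_lt_pow_right (by norm_num) (by omega)
          omega
        · omega)
    have h2 := h1.norm_le_of_zero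
    have hje : x.2 + 1 ≤ 2 ^ e := by omega
    have h3 := padicValNat_choose_two_pow (E := e) (j := x.2 + 1) (Nat.succ_pos x.2) hje
    have h4 := padicValNat_choose_two_pow (E := e - 1) (j := x.2 + 1) (Nat.succ_pos x.2) hx.2
    have h5 := hasResidue_one_iff.1 (HasResidue.natCast (Nat.choose_pos hje).ne')
    have h6 := hasResidue_one_iff.1
      (HasResidue.natCast (a := (2 ^ (e - 1)).choose (x.2 + 1)) (Nat.choose_pos hx.2).ne')
    have h7 : ‖((2 ^ (e - 1)).choose (x.2 + 1) : ℚ_[2])‖ =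
        2 * ‖((2 ^ e).choose (x.2 + 1) : ℚ_[2])‖ := by
      have he := h.two_le
      rw [h5, h6, ← zpow_one_add₀ two_ne_zero]
      congr 1
      omega
    rw [norm_mul, norm_mul, h7]
    rw [norm_mul, norm_mul] at h2
    have h8 : (2 : ℝ) ^ (-((binOnes n : ℤ) - 1 - binOnes p)) =
        2 * 2 ^ (-((binOnes n : ℤ) - 1 - binOnes p + (0 : ℕ) + 1)) := by
      rw [← zpow_one_add₀ two_ne_zero]
      congr 1
      push_cast
      ring
    rw [h8]
    rw [add_zero] at h2
    linarith
  choose! c hc using hterm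
  have h1 := h0.add (HasResidue.sum hc)
  have h3 := congrArg (fun x : ℚ => (x : ℚ_[2])) (partialStirling_add_sub n q (2 ^ (e - 1)))
  have h4 : ((partialStirling n ((q + 2 ^ (e - 1) : ℕ) : ℤ) : ℚ) : ℚ_[2]) =
      ((partialStirling n (q : ℤ) : ℚ) : ℚ_[2]) +
      ∑ x ∈ Finset.range (q + 1) ×ˢ Finset.range (2 ^ (e - 1)),
        (q.choose x.1 : ℚ_[2]) * ((2 ^ (e - 1)).choose (x.2 + 1) : ℚ_[2]) *
          ((Phi n (x.2 + 1 + x.1) : ℚ) : ℚ_[2]) := by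
    push_cast at h3 ⊢
    rw [← h3]
    ring
  rw [h4]
  exact ⟨_, h1⟩

end ZeroData

/-! ### Similarities of the 2-adic integers and their zeros. -/

/-- A continuous function on `ℤ_2` whose increments at natural numbers by `2 ^ d` have valuation
`t + d` is a similarity of ratio `2 ^ (-t)`. -/
theorem norm_sub_eq_of_hasResidue {t : ℤ} {F : ℤ_[2] → ℚ_[2]} (hF : Continuous F)
    (h : ∀ a d : ℕ, HasResidue (t + d) (F ((a + 2 ^ d : ℕ) : ℤ_[2]) - F (a : ℤ_[2])) 1)
    (x y : ℤ_[2]) : ‖F x - F y‖ = 2 ^ (-t) * ‖x - y‖ := by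
  -- Adding w increments of residue 1 gives residue w; for odd w the valuation is therefore exact.
  have hmul (a d w : ℕ) :
      HasResidue (t + d) (F ((a + 2 ^ d * w : ℕ) : ℤ_[2]) - F (a : ℤ_[2])) (w : ZMod 2) := by
    induction w with
    | zero => simpa using HasResidue.zero _
    | succ w ih =>
      have h1 := (h (a + 2 ^ d * w) d).add ih
      rw [sub_add_sub_cancel] at h1
      rwa [show a + 2 ^ d * (w + 1) = a + 2 ^ d * w + 2 ^ d by ring, Nat.cast_succ,
        add_comm (w : ZMod 2)]
  have hlt (a b : ℕ) (hab : b < a) :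
      ‖F (a : ℤ_[2]) - F (b : ℤ_[2])‖ = 2 ^ (-t) * ‖(a : ℤ_[2]) - (b : ℤ_[2])‖ := by
    obtain ⟨m, rfl⟩ := Nat.exists_eq_add_of_lt hab
    have hm := HasResidue.natCast (Nat.succ_ne_zero m)
    rw [hasResidue_one_iff] at hm
    obtain ⟨w, hw⟩ : 2 ^ padicValNat 2 (m + 1) ∣ m + 1 := pow_padicValNat_dvd
    have hodd : (w : ZMod 2) = 1 := by
      rw [ZMod.natCast_eq_one_iff_odd, ← Nat.not_even_iff_odd, even_iff_two_dvd]
      rintro ⟨z, rfl⟩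
      exact pow_succ_padicValNat_not_dvd (p := 2) (Nat.succ_ne_zero m)
        ⟨z, by rw [pow_succ, mul_assoc]; exact hw⟩
    have h1 := hmul b (padicValNat 2 (m + 1)) w
    rw [← hw, hodd, hasResidue_one_iff] at h1
    rw [show b + m + 1 = b + (m + 1) by ring, h1, PadicInt.norm_def]
    push_cast at hm ⊢
    rw [add_sub_cancel_left, hm, neg_add, zpow_add₀ two_ne_zero]
  have hnat (a b : ℕ) :
      ‖F (a : ℤ_[2]) - F (b : ℤ_[2])‖ = 2 ^ (-t) * ‖(a : ℤ_[2]) - (b : ℤ_[2])‖ := by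
    rcases lt_trichotomy a b with hab | rfl | hab
    · rw [norm_sub_rev, norm_sub_rev (a : ℤ_[2])]
      exact hlt b a hab
    · simp
    · exact hlt a b hab
  have hc : Continuous fun z : ℤ_[2] × ℤ_[2] => ‖F z.1 - F z.2‖ := by fun_prop
  have hc' : Continuous fun z : ℤ_[2] × ℤ_[2] => (2 : ℝ) ^ (-t) * ‖z.1 - z.2‖ := by fun_prop
  have heq := (PadicInt.denseRange_natCast.prodMap PadicInt.denseRange_natCast).equalizer hc hc'
    (by
      funext z
      exact hnat z.1 z.2)
  exact congrFun heq (x, y)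

/-- Such a function has a zero, as soon as one of its values is divisible by `2 ^ t`. -/
theorem exists_eq_zero_of_norm_sub_eq {t : ℤ} {F : ℤ_[2] → ℚ_[2]} (hF : Continuous F)
    (h : ∀ x y, ‖F x - F y‖ = 2 ^ (-t) * ‖x - y‖) (h0 : ∃ c, HasResidue t (F 0) c) :
    ∃ x, F x = 0 := by
  -- Digit by digit: if F(x) has odd residue at level t+d, adding 2^d to x cancels it.
  have happrox (d : ℕ) : ∃ x c, HasResidue (t + d) (F x) c := by
    induction d with
    | zero =>
      obtain ⟨c, hc⟩ := h0
      exact ⟨0, c, by simpa using hc⟩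
    | succ d ih =>
      have hs : t + d + 1 = t + (d + 1 : ℕ) := by push_cast; ring
      obtain ⟨x, c, hc⟩ := ih
      have hcases : ∀ c : ZMod 2, c = 0 ∨ c = 1 := by decide
      rcases hcases c with rfl | rfl
      · refine ⟨x, ?_⟩
        rw [← hs, exists_hasResidue_iff]
        exact hc.norm_le_of_zero
      · have h1 : HasResidue (t + d) (F (x + 2 ^ d) - F x) 1 := by
          rw [hasResidue_one_iff, h, add_sub_cancel_left, PadicInt.norm_def]
          have := hasResidue_one_iff.1 (HasResidue.two_pow d)
          push_cast
          rw [show ((2 : ℤ_[2]) : ℚ_[2]) = 2 from rfl, this, neg_add, zpow_add₀ two_ne_zero]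
        have h2 := h1.add hc
        rw [sub_add_cancel, show (1 + 1 : ZMod 2) = 0 from rfl] at h2
        refine ⟨x + 2 ^ d, ?_⟩
        rw [← hs, exists_hasResidue_iff]
        exact h2.norm_le_of_zero
  -- By compactness ‖F‖ attains its minimum, which the approximations force below 2^(-t-d) for every
  -- d.
  obtain ⟨x, -, hx⟩ := isCompact_univ.exists_isMinOn Set.univ_nonempty
    (hF.norm.continuousOn (s := Set.univ))
  refine ⟨x, norm_le_zero_iff.1 (ge_of_tendsto' (x := Filter.atTop)
    (f := fun d : ℕ => (2 : ℝ) ^ (-t) * (1 / 2) ^ d) ?_ fun d => ?_)⟩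
  · have := (tendsto_pow_atTop_nhds_zero_of_lt_one (r := (1 / 2 : ℝ)) (by norm_num)
      (by norm_num)).const_mul ((2 : ℝ) ^ (-t))
    rwa [mul_zero] at this
  · obtain ⟨y, hy⟩ := happrox d
    refine (hx (Set.mem_univ y)).trans ((exists_hasResidue_iff.1 hy).trans (le_of_eq ?_))
    rw [neg_add, zpow_add₀ two_ne_zero, zpow_neg _ (d : ℤ), zpow_natCast, one_div, inv_pow]

theorem nu_eq_nu_add {t : ℤ} {x y : ℚ_[2]} (h : ‖x‖ = 2 ^ (-t) * ‖y‖) : nu x = nu y + t := by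
  rcases eq_or_ne y 0 with rfl | hy
  · rw [norm_zero, mul_zero, norm_eq_zero] at h
    rw [h]
    unfold nu
    rw [AddValuation.map_zero, WithTop.top_add]
  · have h1 : nu y = (y.valuation : WithTop ℤ) := Padic.addValuation.apply hy
    rw [h1, ← WithTop.coe_add, nu_eq_iff, h, Padic.norm_eq_zpow_neg_valuation hy, neg_add,
      zpow_add₀ two_ne_zero, mul_comm]
    push_cast
    rfl

/-! ### Assembling the theorem. -/

namespace ZeroData

variable {e n r p q : ℕ}

theorem exists_zero (h : ZeroData e n r p q) {δ : ℕ} (hδ : δ ≤ 1) :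
    ∃ xδ : ℤ_[2],
      (∀ x : ℤ,
        nu ((partialStirling n (2 ^ e * x + 2 ^ (e - 1) * (δ : ℤ) + (q : ℤ)) : ℚ) : ℚ_[2]) =
          nu (((x : ℤ_[2]) - xδ : ℤ_[2]) : ℚ_[2]) +
            (((binOnes n : ℤ) - 1 - (binOnes p : ℤ) : ℤ) : WithTop ℤ)) ∧
      (∀ z : ℤ_[2],
        (2 : ℤ_[2]) ^ e ∣ z - (2 ^ (e - 1) * (δ : ℤ_[2]) + (q : ℤ_[2])) →
          (partialStirlingFun n z = 0 ↔
            z = 2 ^ e * xδ + 2 ^ (e - 1) * (δ : ℤ_[2]) + (q : ℤ_[2]))) := by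
  obtain ⟨F, hFdef⟩ : ∃ F : ℤ_[2] → ℚ_[2], F = fun x => partialStirlingFun n
    (2 ^ e * x + 2 ^ (e - 1) * (δ : ℤ_[2]) + (q : ℤ_[2])) := ⟨_, rfl⟩
  have hF : Continuous F := by
    rw [hFdef]
    exact (continuous_partialStirlingFun n).comp (by fun_prop)
  have hint (x : ℤ) : F (x : ℤ_[2]) =
      ((partialStirling n (2 ^ e * x + 2 ^ (e - 1) * (δ : ℤ) + (q : ℤ)) : ℚ) : ℚ_[2]) := by
    rw [hFdef, ← partialStirlingFun_intCast]
    push_cast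
    rfl
  have hnat (x : ℕ) : F (x : ℤ_[2]) =
      ((partialStirling n ((2 ^ e * x + (q + δ * 2 ^ (e - 1)) : ℕ) : ℤ) : ℚ) : ℚ_[2]) := by
    rw [← Int.cast_natCast, hint]
    congr 2
    push_cast
    ring
  have hlt : q + δ * 2 ^ (e - 1) < 2 ^ e := by
    have h4 := h.q_lt
    have h5 := h.two_pow_e
    have h6 : δ * 2 ^ (e - 1) ≤ 1 * 2 ^ (e - 1) := Nat.mul_le_mul_right _ hδ
    omega
  have hsim := norm_sub_eq_of_hasResidue (t := (binOnes n : ℤ) - 1 - binOnes p) hF (by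
    intro a d
    rw [hnat, hnat]
    have h1 := h.hasResidue_partialStirling_add_sub d hδ
      (Y := 2 ^ e * a + (q + δ * 2 ^ (e - 1))) (by rw [Nat.mul_add_mod, Nat.mod_eq_of_lt hlt])
    rwa [show 2 ^ e * (a + 2 ^ d) + (q + δ * 2 ^ (e - 1)) =
      2 ^ e * a + (q + δ * 2 ^ (e - 1)) + 2 ^ (e + d) by ring])
  obtain ⟨x₀, hx₀⟩ := exists_eq_zero_of_norm_sub_eq hF hsim (by
    have h1 := hnat 0
    rw [Nat.cast_zero] at h1
    rw [h1, mul_zero, zero_add]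
    exact h.exists_hasResidue_partialStirling hδ)
  refine ⟨x₀, fun x => ?_, fun z hz => ?_⟩
  · rw [← hint]
    refine nu_eq_nu_add ?_
    have h1 := hsim x x₀
    rwa [hx₀, sub_zero, PadicInt.norm_def] at h1
  · obtain ⟨x, hx⟩ := hz
    have hz' : z = 2 ^ e * x + 2 ^ (e - 1) * (δ : ℤ_[2]) + (q : ℤ_[2]) := by
      linear_combination hx
    have h1 : partialStirlingFun n z = F x := by rw [hFdef, hz']
    have h2 := hsim x x₀
    rw [hx₀, sub_zero] at h2
    have h3 : (2 : ℝ) ^ (-((binOnes n : ℤ) - 1 - binOnes p)) ≠ 0 := by positivity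
    rw [h1, ← norm_eq_zero, h2, mul_eq_zero, or_iff_right h3, norm_eq_zero, sub_eq_zero, hz',
      add_assoc, add_assoc, add_left_inj]
    constructor
    · rintro rfl
      rfl
    · exact mul_left_cancel₀ (pow_ne_zero _ two_ne_zero)

end ZeroData

theorem ZeroData.of_hypotheses {e n p q ε : ℕ}
    (hn₁ : 3 * 2 ^ (e - 1) < n) (hn₂ : n < 2 ^ (e + 1))
    (hp : p ≤ (n - 3 * 2 ^ (e - 1)) / 2)
    (hnp : (n, p) ≠ (2 ^ (e + 1) - 1, 0))
    (hodd : Odd ((n - 1 - p).choose p))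
    (hε : ε = 0 ∨ ε = 1)
    (hq : (q : ℚ) = (p : ℚ) + (ε : ℚ) * (2 : ℚ) ^ ((padicValNat 2 n : ℤ) - 1)) :
    ZeroData e n (2 ^ (e + 1) - n) p q := by
  -- For e = 0 the truncated e-1 is 0, and 3 < n < 2 is impossible.
  have he : 1 ≤ e := by
    by_contra hc
    obtain rfl : e = 0 := by omega
    simp only [Nat.zero_sub, pow_zero, zero_add, pow_one] at hn₁ hn₂
    omega
  obtain ⟨e, rfl⟩ := Nat.exists_eq_add_of_le' he
  rw [Nat.add_sub_cancel] at *
  have h1 : 2 ^ (e + 1 + 1) = 4 * 2 ^ e := by ring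
  refine ⟨by omega, by omega, ?_, ?_, ?_, ?_, ?_⟩
  · rw [Nat.add_sub_cancel]
    omega
  · rw [Nat.add_sub_cancel]
    omega
  · by_contra hc
    refine hnp (Prod.ext ?_ ?_)
    · simp only
      omega
    · simp only
      omega
  · exact padicValNat.eq_zero_of_not_dvd (by
      rwa [← even_iff_two_dvd, Nat.not_even_iff_odd])
  · rcases hε with rfl | rfl
    · left
      rw [Nat.cast_zero, zero_mul, add_zero] at hq
      exact_mod_cast hq
    · right
      rw [Nat.cast_one, one_mul] at hq
      have hn : n ≠ 0 := by omega
      -- For odd n and ε = 1 the number q would be a half-integer.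
      rcases Nat.eq_zero_or_pos (padicValNat 2 n) with h0 | h0
      · exfalso
        rw [h0] at hq
        have h2 : ((2 * q : ℕ) : ℚ) = ((2 * p + 1 : ℕ) : ℚ) := by
          push_cast
          rw [hq]
          norm_num
          ring
        have h3 : 2 * q = 2 * p + 1 := by exact_mod_cast h2
        omega
      · obtain ⟨w, hw⟩ := Nat.exists_eq_add_of_le' h0
        refine ⟨w, ?_, ?_⟩
        · obtain ⟨z, hz⟩ : 2 ^ padicValNat 2 n ∣ n := pow_padicValNat_dvd
          have hz2 : ¬ 2 ∣ z := by
            rintro ⟨y, rfl⟩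
            exact pow_succ_padicValNat_not_dvd (p := 2) hn
              ⟨y, by rw [pow_succ, mul_assoc]; exact hz⟩
          rw [hw] at hz
          obtain ⟨y, rfl⟩ : ∃ y, z = 2 * y + 1 := ⟨z / 2, by omega⟩
          rw [hz, show 2 ^ (w + 1) * (2 * y + 1) = 2 ^ (w + 2) * y + 2 ^ (w + 1) by ring,
            Nat.mul_add_mod, Nat.mod_eq_of_lt (Nat.pow_lt_pow_right (by norm_num) (by omega))]
        · rw [hw] at hq
          push_cast at hq
          rw [add_sub_cancel_right, zpow_natCast] at hq
          exact_mod_cast hq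

theorem theorem3p6 (e n p q ε δ : ℕ)
    (hn₁ : 3 * 2 ^ (e - 1) < n) (hn₂ : n < 2 ^ (e + 1))
    (hp : p ≤ (n - 3 * 2 ^ (e - 1)) / 2)
    (hnp : (n, p) ≠ (2 ^ (e + 1) - 1, 0))
    (hodd : Odd ((n - 1 - p).choose p))
    (hε : ε = 0 ∨ ε = 1)
    (hq : (q : ℚ) = (p : ℚ) + (ε : ℚ) * (2 : ℚ) ^ ((padicValNat 2 n : ℤ) - 1))
    (hδ : δ = 0 ∨ δ = 1) :
    (∀ (x : ℤ) (k j : ℕ), 0 < j →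
      (((binOnes n : ℤ) - 1 - (binOnes p : ℤ) : ℤ) : WithTop ℤ) ≤
        nu (((Ring.choose (2 ^ e * x + (δ : ℤ) * 2 ^ (e - 1) + (q : ℤ) : ℤ) k : ℤ) : ℚ_[2]) *
          ((2 ^ e).choose j : ℚ_[2]) * ((Phi n (j + k) : ℚ) : ℚ_[2])) ∧
      (nu (((Ring.choose (2 ^ e * x + (δ : ℤ) * 2 ^ (e - 1) + (q : ℤ) : ℤ) k : ℤ) : ℚ_[2]) *
          ((2 ^ e).choose j : ℚ_[2]) * ((Phi n (j + k) : ℚ) : ℚ_[2])) =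
        (((binOnes n : ℤ) - 1 - (binOnes p : ℤ) : ℤ) : WithTop ℤ) ↔
        ((j : ℤ) = 2 ^ e - 2 ^ Nat.log 2 (2 ^ (e + 1) - (n - p)) ∧ k = p) ∨
        (δ = 1 ∧
          (((j : ℤ) = 2 ^ (e - 1) - 2 ^ Nat.log 2 (2 ^ (e + 1) - (n - p)) ∧
              k = 2 ^ (e - 1) + p) ∨
            (j = 2 ^ (e - 1) ∧
              (k : ℤ) = 2 ^ (e - 1) + p - 2 ^ Nat.log 2 (2 ^ (e + 1) - (n - p))))))) ∧
    (∃ xδ : ℤ_[2],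
      (∀ x : ℤ,
        nu ((partialStirling n (2 ^ e * x + 2 ^ (e - 1) * (δ : ℤ) + (q : ℤ)) : ℚ) : ℚ_[2]) =
          nu (((x : ℤ_[2]) - xδ : ℤ_[2]) : ℚ_[2]) +
            (((binOnes n : ℤ) - 1 - (binOnes p : ℤ) : ℤ) : WithTop ℤ)) ∧
      (∀ z : ℤ_[2],
        (2 : ℤ_[2]) ^ e ∣ z - (2 ^ (e - 1) * (δ : ℤ_[2]) + (q : ℤ_[2])) →
          (partialStirlingFun n z = 0 ↔
            z = 2 ^ e * xδ + 2 ^ (e - 1) * (δ : ℤ_[2]) + (q : ℤ_[2])))) := by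
  have h := ZeroData.of_hypotheses hn₁ hn₂ hp hnp hodd hε hq
  have hδ1 : δ ≤ 1 := by omega
  refine ⟨fun x k j hj => ?_, h.exists_zero hδ1⟩
  classical
  have hr : 2 ^ (e + 1) - (n - p) = 2 ^ (e + 1) - n + p := by
    have := h.add_eq
    have := h.add_lt
    have := h.two_pow_e_succ
    omega
  have hy : (2 ^ e : ℤ) ∣ 2 ^ e * x + (δ : ℤ) * 2 ^ (e - 1) + (q : ℤ) - (q + δ * 2 ^ (e - 1)) :=
    ⟨x, by ring⟩
  have hres := h.hasResidue_term_int (j := j) (k := k) hδ1 hj hy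
    (if MinimalPair e (Nat.log 2 (2 ^ (e + 1) - n + p)) p δ j k then 1 else 0)
    (by split_ifs with h1 <;> simp [h1])
  refine ⟨hres.le_nu, hres.nu_eq_iff.trans ?_⟩
  rw [hr]
  generalize Nat.log 2 (2 ^ (e + 1) - n + p) = l
  have hpow : ((2 ^ e : ℕ) : ℤ) = 2 ^ e ∧ ((2 ^ (e - 1) : ℕ) : ℤ) = 2 ^ (e - 1) ∧
      ((2 ^ l : ℕ) : ℤ) = 2 ^ l := by
    push_cast
    exact ⟨rfl, rfl, rfl⟩
  have h01 : (if MinimalPair e l p δ j k then (1 : ZMod 2) else 0) = 1 ↔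
      MinimalPair e l p δ j k := by
    split_ifs with h1 <;> simp [h1]
  rw [h01, ← hpow.1, ← hpow.2.1, ← hpow.2.2]
  unfold MinimalPair
  omega
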